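/- An instance of the Fault-Tolerant Path problem with parameter $k$ ($k$-FTP), for a fixed integer $k\ge 0$, consists of a finite directed graph $G=(V,E)$ (parallel edges allowed) with nonnegative rational edge weights $w$, two nodes $s,t\in V$, and a set $M\subseteq E$ of edges that may fail. A set $S\subseteq E$ is feasible if $S\setminus F$ contains a directed $s$-$t$ path for every $F\subseteq M$ with $|F|\le k$. The task is to find a feasible set $S$ of minimum total weight $\sum_{e\in S}w(e)$, or to report that no feasible set exists. Theorem. For every fixed integer $k\ge 0$ there is a polynomial-time algorithm for $k$-FTP restricted to instances whose graph $G$ is acyclic (has no directed cycle). That is, there are an algorithm and a polynomial $p_k$, both depending only on $k$, such that the algorithm solves every such instance in at most $p_k(N)$ steps, where $N$ is $|V|+|E|$ plus the total number of bits of the numerators and denominators of the weights. (Steps are counted on a random access machine whose unit-cost instructions are addition, truncated subtraction and halving of natural numbers, loading constants, indirect array access and tests for zero.) -/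

import Mathlib

/-! ### The machine model

A random access machine with addition, truncated subtraction and halving, programmed by
structured `while` programs. There is no multiplication, so after `t` steps every number has at
most `t` more bits than the largest number (in the input or in the program text) at the start:
counting one time unit per instruction is therefore polynomially equivalent to counting bit
operations, and polynomial time on this machine is polynomial time on a Turing machine. -/

namespace RAM

/-- The memory: natural-number registers and natural-number arrays. A program names its registers
and arrays by constants, so it uses finitely many of them; array cells are addressed indirectly. -/
structure Store where
  reg : ℕ → ℕ
  arr : ℕ → ℕ → ℕ

/-- The store after `reg x := c`. -/
def Store.setReg (σ : Store) (x c : ℕ) : Store :=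
  { σ with reg := Function.update σ.reg x c }

/-- The store after `arr a [i] := c`. -/
def Store.setArr (σ : Store) (a i c : ℕ) : Store :=
  { σ with arr := Function.update σ.arr a (Function.update (σ.arr a) i c) }

/-- Programs. The letters `x y z i` are names of registers, `a` is the name of an array. -/
inductive Prog where
  /-- `x := c` for a literal `c` -/
  | const (x c : ℕ)
  /-- `x := y + z` -/
  | add (x y z : ℕ)
  /-- `x := y - z`, truncated at `0` -/
  | sub (x y z : ℕ)
  /-- `x := ⌊y / 2⌋` -/
  | half (x y : ℕ)
  /-- `x := a[i]` -/
  | load (x a i : ℕ)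
  /-- `a[i] := x` -/
  | store (a i x : ℕ)
  /-- `P; Q` -/
  | seq (P Q : Prog)
  /-- `if x ≠ 0 then P else Q` -/
  | ite (x : ℕ) (P Q : Prog)
  /-- `while x ≠ 0 do P` -/
  | loop (x : ℕ) (P : Prog)

/-- `Exec P σ t τ`: started in the store `σ`, the program `P` halts in the store `τ` after exactly
`t` steps. Every assignment and every evaluation of a test is one step. -/
inductive Exec : Prog → Store → ℕ → Store → Prop where
  | const (x c : ℕ) (σ : Store) : Exec (.const x c) σ 1 (σ.setReg x c)
  | add (x y z : ℕ) (σ : Store) : Exec (.add x y z) σ 1 (σ.setReg x (σ.reg y + σ.reg z))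
  | sub (x y z : ℕ) (σ : Store) : Exec (.sub x y z) σ 1 (σ.setReg x (σ.reg y - σ.reg z))
  | half (x y : ℕ) (σ : Store) : Exec (.half x y) σ 1 (σ.setReg x (σ.reg y / 2))
  | load (x a i : ℕ) (σ : Store) : Exec (.load x a i) σ 1 (σ.setReg x (σ.arr a (σ.reg i)))
  | store (a i x : ℕ) (σ : Store) : Exec (.store a i x) σ 1 (σ.setArr a (σ.reg i) (σ.reg x))
  | seq {P Q : Prog} {σ τ υ : Store} {t u : ℕ} (hP : Exec P σ t τ) (hQ : Exec Q τ u υ) :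
      Exec (.seq P Q) σ (t + u) υ
  | ite_true {x : ℕ} {P Q : Prog} {σ τ : Store} {t : ℕ} (hx : σ.reg x ≠ 0) (hP : Exec P σ t τ) :
      Exec (.ite x P Q) σ (t + 1) τ
  | ite_false {x : ℕ} {P Q : Prog} {σ τ : Store} {t : ℕ} (hx : σ.reg x = 0) (hQ : Exec Q σ t τ) :
      Exec (.ite x P Q) σ (t + 1) τ
  | loop_stop {x : ℕ} {P : Prog} {σ : Store} (hx : σ.reg x = 0) : Exec (.loop x P) σ 1 σ
  | loop_step {x : ℕ} {P : Prog} {σ τ υ : Store} {t u : ℕ} (hx : σ.reg x ≠ 0)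
      (hP : Exec P σ t τ) (hrest : Exec (.loop x P) τ u υ) : Exec (.loop x P) σ (t + 1 + u) υ

/-- A computational problem with instances in `ι`, restricted to the instances satisfying
`promise`, is solvable in polynomial time: one program, started on the encoding `input I` of any
such instance `I`, halts with a correct output within a number of steps that is bounded by one
polynomial in `size I`. -/
def SolvableInPolyTime {ι : Type} (promise : ι → Prop) (input : ι → Store) (size : ι → ℕ)
    (correct : ι → Store → Prop) : Prop :=
  ∃ (P : Prog) (p : Polynomial ℕ), ∀ I : ι, promise I →
    ∃ (t : ℕ) (τ : Store), Exec P (input I) t τ ∧ t ≤ p.eval (size I) ∧ correct I τ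

end RAM

/-! ### The fault-tolerant path problem on directed graphs -/

/-- An instance of the fault-tolerant path problem, without the parameter `k`: a finite directed
graph (parallel edges are allowed) with nonnegative rational edge weights, a set `M` of edges that
may fail, and two nodes `s` and `t`. -/
structure FTPInstance where
  /-- number of vertices -/
  n : ℕ
  /-- number of edges -/
  m : ℕ
  tail : Fin m → Fin n
  head : Fin m → Fin n
  weight : Fin m → ℚ≥0
  M : Finset (Fin m)
  s : Fin n
  t : Fin n

namespace FTPInstance

/-- Some edge of `S` leads from `u` to `v`. -/
def Adj (I : FTPInstance) (S : Finset (Fin I.m)) (u v : Fin I.n) : Prop :=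
  ∃ e ∈ S, I.tail e = u ∧ I.head e = v

/-- The graph has no directed cycle. -/
def IsAcyclic (I : FTPInstance) : Prop :=
  ∀ v, ¬ Relation.TransGen (I.Adj Finset.univ) v v

/-- The edge set `S` contains a directed path from `s` to `t`. -/
def ContainsPath (I : FTPInstance) (S : Finset (Fin I.m)) : Prop :=
  Relation.ReflTransGen (I.Adj S) I.s I.t

/-- `S \ F` contains a path from `s` to `t` for every set `F ⊆ M` of at most `k` faults. -/
def IsFeasible (I : FTPInstance) (k : ℕ) (S : Finset (Fin I.m)) : Prop :=
  ∀ F ⊆ I.M, F.card ≤ k → I.ContainsPath (S \ F)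

/-- The cost of an edge set. -/
def cost (I : FTPInstance) (S : Finset (Fin I.m)) : ℚ≥0 :=
  ∑ e ∈ S, I.weight e

/-- `S` is a feasible set of minimum cost. -/
def IsOptimal (I : FTPInstance) (k : ℕ) (S : Finset (Fin I.m)) : Prop :=
  I.IsFeasible k S ∧ ∀ S', I.IsFeasible k S' → I.cost S ≤ I.cost S'

/-- The size of an instance: the number of vertices and edges plus the lengths of the binary
representations of the numerators and denominators of the weights. -/
def size (I : FTPInstance) : ℕ :=
  I.n + I.m + ∑ e, (Nat.size (I.weight e).num + Nat.size (I.weight e).den)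

/-- The array holding `f 0, …, f (m - 1)`, followed by zeros. -/
def toArray {m : ℕ} (f : Fin m → ℕ) (i : ℕ) : ℕ :=
  if h : i < m then f ⟨i, h⟩ else 0

/-- The encoding of an instance. Registers `0, …, 3` hold `n`, `m`, `s`, `t`; arrays `0, …, 4`
hold, edge by edge, the tail, the head, the numerator and the denominator of the weight in lowest
terms, and whether the edge may fail (`1`) or not (`0`). All other memory is zero. -/
def input (I : FTPInstance) : RAM.Store where
  reg
    | 0 => I.n
    | 1 => I.m
    | 2 => I.s
    | 3 => I.t
    | _ => 0
  arr
    | 0 => toArray fun e => I.tail e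
    | 1 => toArray fun e => I.head e
    | 2 => toArray fun e => (I.weight e).num
    | 3 => toArray fun e => (I.weight e).den
    | 4 => toArray fun e => if e ∈ I.M then 1 else 0
    | _ => fun _ => 0

/-- The edge set written in array `0`, as its set of nonzero entries. -/
def outputSet (I : FTPInstance) (τ : RAM.Store) : Finset (Fin I.m) :=
  Finset.univ.filter fun e => τ.arr 0 e ≠ 0

/-- The final store `τ` solves the instance for the parameter `k`: either register `0` is nonzero
and the output set is an optimal solution, or register `0` is zero and there is no feasible set. -/
def IsCorrectOutput (k : ℕ) (I : FTPInstance) (τ : RAM.Store) : Prop :=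
  (τ.reg 0 ≠ 0 ∧ I.IsOptimal k (I.outputSet τ)) ∨
    (τ.reg 0 = 0 ∧ ∀ S, ¬ I.IsFeasible k S)

end FTPInstance

/-! Send `k + 1` tokens from `s` to `t` along edges of `S`, so that an edge of `M` carries at most
one token and any other edge carries any number. If this is possible, then `k` faults hit at most
`k` of the `k + 1` routes, so `S` is feasible (`Routable.isFeasible`). Conversely, give edges of `M`
capacity `1` and the others capacity `k + 1`. If `S` is feasible, every cut between `s` and `t` has
capacity at least `k + 1`, since a cheaper cut would consist of at most `k` edges of `M`
(`IsFeasible.covers`).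

The tokens are moved edge by edge, in an order in which all edges entering a vertex precede those
leaving it; such an order exists because the graph is acyclic. The invariant `Covers` is the cut
condition for the current token positions and the edges not yet treated. The central lemma
`Covers.exists_move` is an integral max-flow argument done one edge at a time: by uncrossing, a
suitable number of tokens can cross the next edge so that the condition persists once the edge is
deleted. When no edge is left, `Covers.eq_t` places all tokens in `t`.

This gives a dynamic program over the `n ^ (k + 1)` configurations. A table entry is the cost of the
edges bought so far, an edge being paid once however many tokens cross it. Soundness (`SoundTable`)
says that finite entries are costs of actual routings; completeness (`CompleteTable`) follows an
arbitrary feasible set through the program by means of `Covers.exists_move`. Hence the entry for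
"all tokens in `t`" is the optimum.

To recover the edge set without back pointers, weights are scaled to integers divisible by `2 ^ m`,
and `2 ^ e` is added to the weight of edge `e`. The low bits of a cost then spell out the set
(`sum_codeWeight_bit`), and they are too small to disturb comparisons of true costs
(`cost_le_of_sum_codeWeight_le`).

The rest implements this on the machine. Each program comes with a specification `Runs` bounding its
time by an explicit polynomial expression in one parameter `Z`, which is itself polynomial in the
instance size for fixed `k`. -/

namespace RAM

/-! ### Reasoning about programs -/

/-- Started in `σ`, the program `P` halts, and its running time and final store satisfy `Q`. -/
def Runs (P : Prog) (σ : Store) (Q : ℕ → Store → Prop) : Prop :=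
  ∃ t τ, Exec P σ t τ ∧ Q t τ

theorem Runs.mono {P : Prog} {σ : Store} {Q Q' : ℕ → Store → Prop} (h : Runs P σ Q)
    (hQ : ∀ t τ, Q t τ → Q' t τ) : Runs P σ Q' := by
  obtain ⟨t, τ, h, h'⟩ := h
  exact ⟨t, τ, h, hQ _ _ h'⟩

variable {σ τ : Store} {Q : ℕ → Store → Prop}

@[simp] theorem runs_const {x c : ℕ} : Runs (.const x c) σ Q ↔ Q 1 (σ.setReg x c) :=
  ⟨by rintro ⟨_, _, ⟨⟩, h⟩; exact h, fun h => ⟨_, _, .const .., h⟩⟩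

@[simp] theorem runs_add {x y z : ℕ} :
    Runs (.add x y z) σ Q ↔ Q 1 (σ.setReg x (σ.reg y + σ.reg z)) :=
  ⟨by rintro ⟨_, _, ⟨⟩, h⟩; exact h, fun h => ⟨_, _, .add .., h⟩⟩

@[simp] theorem runs_sub {x y z : ℕ} :
    Runs (.sub x y z) σ Q ↔ Q 1 (σ.setReg x (σ.reg y - σ.reg z)) :=
  ⟨by rintro ⟨_, _, ⟨⟩, h⟩; exact h, fun h => ⟨_, _, .sub .., h⟩⟩

@[simp] theorem runs_half {x y : ℕ} :
    Runs (.half x y) σ Q ↔ Q 1 (σ.setReg x (σ.reg y / 2)) :=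
  ⟨by rintro ⟨_, _, ⟨⟩, h⟩; exact h, fun h => ⟨_, _, .half .., h⟩⟩

@[simp] theorem runs_load {x a i : ℕ} :
    Runs (.load x a i) σ Q ↔ Q 1 (σ.setReg x (σ.arr a (σ.reg i))) :=
  ⟨by rintro ⟨_, _, ⟨⟩, h⟩; exact h, fun h => ⟨_, _, .load .., h⟩⟩

@[simp] theorem runs_store {x a i : ℕ} :
    Runs (.store a i x) σ Q ↔ Q 1 (σ.setArr a (σ.reg i) (σ.reg x)) :=
  ⟨by rintro ⟨_, _, ⟨⟩, h⟩; exact h, fun h => ⟨_, _, .store .., h⟩⟩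

@[simp] theorem runs_seq {P P' : Prog} :
    Runs (.seq P P') σ Q ↔ Runs P σ fun t τ => Runs P' τ fun u υ => Q (t + u) υ := by
  constructor
  · rintro ⟨_, _, h, hQ⟩
    cases h with
    | seq h1 h2 => exact ⟨_, _, h1, _, _, h2, hQ⟩
  · rintro ⟨_, _, h1, _, _, h2, hQ⟩
    exact ⟨_, _, .seq h1 h2, hQ⟩

theorem runs_ite {x : ℕ} {P P' : Prog} (h1 : σ.reg x ≠ 0 → Runs P σ fun t τ => Q (t + 1) τ)
    (h2 : σ.reg x = 0 → Runs P' σ fun t τ => Q (t + 1) τ) : Runs (.ite x P P') σ Q := by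
  by_cases hx : σ.reg x = 0
  · obtain ⟨_, _, h, hQ⟩ := h2 hx
    exact ⟨_, _, .ite_false hx h, hQ⟩
  · obtain ⟨_, _, h, hQ⟩ := h1 hx
    exact ⟨_, _, .ite_true hx h, hQ⟩

/-- A loop with a decreasing measure. -/
theorem runs_loop {x T : ℕ} {P : Prog} (Inv : Store → Prop) (meas : Store → ℕ)
    (step : ∀ τ, Inv τ → τ.reg x ≠ 0 →
      Runs P τ fun t υ => t ≤ T ∧ Inv υ ∧ meas υ < meas τ) :
    ∀ (N : ℕ) (σ : Store), Inv σ → meas σ ≤ N →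
      Runs (.loop x P) σ fun t τ => t ≤ N * (T + 1) + 1 ∧ Inv τ ∧ τ.reg x = 0 := by
  intro N
  induction N with
  | zero =>
    intro σ hσ hN
    by_cases hx : σ.reg x = 0
    · exact ⟨_, _, Exec.loop_stop hx, by omega, hσ, hx⟩
    · obtain ⟨_, _, _, _, _, h⟩ := step σ hσ hx
      omega
  | succ N ih =>
    intro σ hσ hN
    by_cases hx : σ.reg x = 0
    · exact ⟨_, _, Exec.loop_stop hx, by omega, hσ, hx⟩
    · obtain ⟨t, τ, hP, ht, hτ, h⟩ := step σ hσ hx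
      obtain ⟨u, υ, hu, hu', h'⟩ := ih τ hτ (by omega)
      exact ⟨_, _, .loop_step hx hP hu, by rw [add_mul]; omega, h'⟩

/-! ### Memory access and frames; inner programs use higher registers, so a frame bound protects the
data of outer ones. -/

@[simp] theorem reg_setReg (σ : Store) (x c y : ℕ) :
    (σ.setReg x c).reg y = if y = x then c else σ.reg y := by
  simp [Store.setReg, Function.update_apply]

@[simp] theorem arr_setReg (σ : Store) (x c : ℕ) : (σ.setReg x c).arr = σ.arr := rfl

@[simp] theorem reg_setArr (σ : Store) (a i c : ℕ) : (σ.setArr a i c).reg = σ.reg := rfl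

theorem arr_setArr (σ : Store) (a i c b : ℕ) :
    (σ.setArr a i c).arr b = if b = a then Function.update (σ.arr a) i c else σ.arr b := by
  simp only [Store.setArr, Function.update_apply]

@[simp] theorem arr_setArr_same (σ : Store) (a i c : ℕ) :
    (σ.setArr a i c).arr a = Function.update (σ.arr a) i c := by
  simp [arr_setArr]

@[simp] theorem arr_setArr_of_ne (σ : Store) {a b : ℕ} (i c : ℕ) (h : b ≠ a) :
    (σ.setArr a i c).arr b = σ.arr b := by
  simp [arr_setArr, h]

/-- The registers below `b` are the same in both stores. -/
def Frame (b : ℕ) (σ τ : Store) : Prop := ∀ r < b, τ.reg r = σ.reg r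

theorem Frame.refl (b : ℕ) (σ : Store) : Frame b σ σ := fun _ _ => rfl

theorem Frame.trans {b c : ℕ} {σ τ υ : Store} (h : Frame b σ τ) (h' : Frame c τ υ)
    (hbc : b ≤ c) : Frame b σ υ :=
  fun r hr => (h' r (hr.trans_le hbc)).trans (h r hr)

theorem Frame.mono {b c : ℕ} (h : Frame c σ τ) (hbc : b ≤ c) : Frame b σ τ :=
  fun r hr => h r (hr.trans_le hbc)

@[simp] theorem frame_setReg {b x c : ℕ} (h : b ≤ x) :
    Frame b σ (τ.setReg x c) ↔ Frame b σ τ := by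
  refine forall₂_congr fun r hr => ?_
  rw [reg_setReg, if_neg (by omega)]

@[simp] theorem frame_setArr {b a i c : ℕ} :
    Frame b σ (τ.setArr a i c) ↔ Frame b σ τ := Iff.rfl

@[simp] theorem setReg_setReg (σ : Store) (x c d : ℕ) :
    (σ.setReg x c).setReg x d = σ.setReg x d := by
  simp [Store.setReg]

/-- `x := y` -/
def copy (x y : ℕ) : Prog := .seq (.const x 0) (.add x x y)

theorem runs_copy {x y : ℕ} (h : y ≠ x) :
    Runs (copy x y) σ Q ↔ Q 2 (σ.setReg x (σ.reg y)) := by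
  simp [copy, h]

/-- `for i := 0, …, lim - 1 do P`; the register `i + 1` is used up. -/
def forLoop (i lim : ℕ) (P : Prog) : Prog :=
  .seq (.const i 0) <| .seq (.sub (i + 1) lim i) <|
    .loop (i + 1) <| .seq P <| .seq (.const (i + 1) 1) <| .seq (.add i i (i + 1)) <|
      .sub (i + 1) lim i

/-- The loop itself writes the registers `i` and `i + 1`, so `stable` asks that the invariant depend
only on the arrays and the registers below `i`. Each round adds one test and three counter
instructions to the body, whence `T + 4`. Time is stated with `Z` instead of `L` so that all bounds
become expressions in one variable. -/
theorem runs_forLoop {i lim T L Z : ℕ} {P : Prog} (Inv : ℕ → Store → Prop)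
    (hi : lim < i) (hL : σ.reg lim = L) (hZ : L ≤ Z)
    (stable : ∀ j τ υ, Inv j τ → Frame i τ υ → υ.arr = τ.arr → Inv j υ)
    (h0 : Inv 0 σ)
    (step : ∀ j < L, ∀ τ, Inv j τ → τ.reg i = j → τ.reg lim = L →
      Runs P τ fun t υ => t ≤ T ∧ υ.reg i = j ∧ υ.reg lim = L ∧ Inv (j + 1) υ) :
    Runs (forLoop i lim P) σ fun t τ => t ≤ Z * (T + 4) + 3 ∧ Inv L τ := by
  have hne : lim ≠ i := hi.ne
  have hne' : lim ≠ i + 1 := by omega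
  simp only [forLoop, runs_seq, runs_const, runs_sub]
  refine (runs_loop (T := T + 3)
    (fun τ => τ.reg i ≤ L ∧ τ.reg lim = L ∧ τ.reg (i + 1) = L - τ.reg i ∧ Inv (τ.reg i) τ)
    (fun τ => τ.reg (i + 1)) ?_ Z _ ?_ ?_).mono ?_
  · rintro τ ⟨hj, hl, hc, hI⟩ hx
    simp only [runs_seq, runs_const, runs_sub, runs_add]
    refine (step _ (by omega) τ hI rfl hl).mono ?_
    rintro t υ ⟨ht, hυ, hυl, hI'⟩
    simp [hne, hne', hυl, hυ]
    refine ⟨by omega, ⟨by omega, ?_⟩, by omega⟩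
    exact stable _ _ _ hI' (by simp [Frame.refl]) (by simp)
  · simp [hne, hne', hL]
    exact stable _ _ _ h0 (by simp [Frame.refl]) (by simp)
  · simpa [hne, hL] using hZ
  · rintro t τ ⟨ht, ⟨hj, hl, hc, hI⟩, hx⟩
    have : τ.reg i = L := by omega
    rw [this] at hI
    refine ⟨by linarith, hI⟩

end RAM

namespace FTPInstance

variable (I : FTPInstance)

/-! ### Ranks -/

/-- The rank counts proper ancestors. Along an edge, the ancestors of the tail remain ancestors of
the head and the tail itself is a new one, by acyclicity. -/
theorem exists_rank (hI : I.IsAcyclic) :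
    ∃ R : Fin I.n → ℕ, (∀ v, R v < I.n) ∧ ∀ e, R (I.tail e) < R (I.head e) := by
  classical
  refine ⟨fun v => (Finset.univ.filter fun u =>
    Relation.TransGen (I.Adj Finset.univ) u v).card, fun v => ?_, fun e => ?_⟩
  · have : (Finset.univ.filter fun u => Relation.TransGen (I.Adj Finset.univ) u v) ⊂
        Finset.univ := by
      refine Finset.filter_ssubset.2 ⟨v, Finset.mem_univ _, hI v⟩
    simpa using Finset.card_lt_card this
  · have hadj : I.Adj Finset.univ (I.tail e) (I.head e) := ⟨e, Finset.mem_univ _, rfl, rfl⟩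
    refine Finset.card_lt_card ((Finset.ssubset_iff_of_subset ?_).2 ⟨I.tail e, ?_, ?_⟩)
    · intro u hu
      simp only [Finset.mem_filter, Finset.mem_univ, true_and] at hu ⊢
      exact hu.tail hadj
    · simpa using Relation.TransGen.single hadj
    · simpa using hI _

/-! ### Cut conditions for token configurations -/

variable {I} {K : ℕ}

/-- The number of tokens in the vertex set `X`. -/
def load (σ : Fin K → Fin I.n) (X : Finset (Fin I.n)) : ℕ := ∑ i, if σ i ∈ X then 1 else 0

/-- How many tokens may use an edge. -/
def capacity (I : FTPInstance) (K : ℕ) (e : Fin I.m) : ℕ := if e ∈ I.M then 1 else K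

/-- The capacity of the edges of `S` that leave `X`. -/
def cutCap (K : ℕ) (S : Finset (Fin I.m)) (X : Finset (Fin I.n)) : ℕ :=
  ∑ e ∈ S, if I.tail e ∈ X ∧ I.head e ∉ X then I.capacity K e else 0

/-- No vertex set avoiding `t` holds more tokens than the edges of `S` can carry out of it. -/
def Covers (S : Finset (Fin I.m)) (σ : Fin K → Fin I.n) : Prop :=
  ∀ X : Finset (Fin I.n), I.t ∉ X → load σ X ≤ cutCap K S X

/-- The configuration after the tokens in `A` have moved to `v`. -/
def move (σ : Fin K → Fin I.n) (A : Finset (Fin K)) (v : Fin I.n) (i : Fin K) : Fin I.n :=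
  if i ∈ A then v else σ i

theorem load_move {σ : Fin K → Fin I.n} {A : Finset (Fin K)} {u v : Fin I.n}
    (hA : ∀ i ∈ A, σ i = u) (X : Finset (Fin I.n)) :
    load (move σ A v) X + (if u ∈ X then A.card else 0) =
      load σ X + (if v ∈ X then A.card else 0) := by
  have key (w : Fin I.n) : (if w ∈ X then A.card else 0) =
      ∑ i : Fin K, if i ∈ A then (if w ∈ X then 1 else 0) else 0 := by
    rw [Finset.sum_ite_mem, Finset.univ_inter, Finset.sum_const]
    split_ifs <;> simp
  rw [key, key, load, load, ← Finset.sum_add_distrib, ← Finset.sum_add_distrib]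
  refine Finset.sum_congr rfl fun i _ => ?_
  by_cases hi : i ∈ A
  · simp only [move, hi, if_true, hA i hi]
    omega
  · simp [move, hi]

theorem load_le (σ : Fin K → Fin I.n) (X : Finset (Fin I.n)) : load σ X ≤ K := by
  refine (Finset.sum_le_card_nsmul _ _ 1 fun i _ => ?_).trans (by simp)
  split_ifs <;> simp

theorem load_union_add_inter (σ : Fin K → Fin I.n) (X Y : Finset (Fin I.n)) :
    load σ (X ∪ Y) + load σ (X ∩ Y) = load σ X + load σ Y := by
  simp only [load, ← Finset.sum_add_distrib]
  refine Finset.sum_congr rfl fun i _ => ?_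
  by_cases h1 : σ i ∈ X <;> by_cases h2 : σ i ∈ Y <;> simp [h1, h2]

/-- Checked edge by edge. Together with the modularity of `load` it allows uncrossing in
`Covers.exists_move`. -/
theorem cutCap_submodular (S : Finset (Fin I.m)) (X Y : Finset (Fin I.n)) :
    cutCap K S (X ∪ Y) + cutCap K S (X ∩ Y) ≤ cutCap K S X + cutCap K S Y := by
  simp only [cutCap, ← Finset.sum_add_distrib]
  refine Finset.sum_le_sum fun e _ => ?_
  by_cases h1 : I.tail e ∈ X <;> by_cases h2 : I.tail e ∈ Y <;>
    by_cases h3 : I.head e ∈ X <;> by_cases h4 : I.head e ∈ Y <;> simp [h1, h2, h3, h4]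

theorem cutCap_erase {S : Finset (Fin I.m)} {e : Fin I.m} (he : e ∈ S)
    (X : Finset (Fin I.n)) :
    cutCap K S X = cutCap K (S.erase e) X +
      if I.tail e ∈ X ∧ I.head e ∉ X then I.capacity K e else 0 :=
  (Finset.sum_erase_add _ _ he).symm

theorem load_erase {σ : Fin K → Fin I.n} {u : Fin I.n} {Y : Finset (Fin I.n)} (hu : u ∈ Y) :
    load σ Y = load σ (Y.erase u) + (Finset.univ.filter fun i => σ i = u).card := by
  rw [Finset.card_filter, load, load, ← Finset.sum_add_distrib]
  refine Finset.sum_congr rfl fun i _ => ?_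
  by_cases h : σ i = u <;> simp [h, hu]

/-- The cut condition survives the removal of an edge whose tail has no incoming edges, if
suitably many tokens first move along that edge. -/
theorem Covers.exists_move {S : Finset (Fin I.m)} {σ : Fin K → Fin I.n} (h : Covers S σ)
    (e : Fin I.m) (hin : ∀ f ∈ S, I.head f ≠ I.tail e) :
    ∃ A : Finset (Fin K), (∀ i ∈ A, σ i = I.tail e) ∧ (A.Nonempty → e ∈ S) ∧
      (e ∈ I.M → A.card ≤ 1) ∧ Covers (S.erase e) (move σ A (I.head e)) := by
  classical
  by_cases he : e ∈ S
  swap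
  · refine ⟨∅, by simp, by simp, by simp, ?_⟩
    have : move σ ∅ (I.head e) = σ := by ext; simp [move]
    rwa [this, Finset.erase_eq_of_notMem he]
  set u := I.tail e with hu
  set v := I.head e with hv
  let 𝒴 : Finset (Finset (Fin I.n)) := Finset.univ.filter fun Y => u ∈ Y ∧ v ∉ Y ∧ I.t ∉ Y
  let c := fun X => cutCap K (S.erase e) X
  -- The number of tokens to move: the largest excess, once `e` is gone, over sets separating `u`
  -- from `v` and avoiding `t`. Fewer moves would violate the condition for a maximizer; more are
  -- never needed.
  let x := 𝒴.sup fun Y => load σ Y - c Y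
  have hle : ∀ Y ∈ 𝒴, load σ Y - c Y ≤ x := fun Y hY =>
    Finset.le_sup (f := fun Y => load σ Y - c Y) hY
  have hx : x = 0 ∨ ∃ Y ∈ 𝒴, x = load σ Y - c Y := by
    rcases 𝒴.eq_empty_or_nonempty with h0 | h0
    · left; simp [x, h0]
    · right; exact Finset.exists_mem_eq_sup _ h0 _
  have hcap : x ≤ I.capacity K e := by
    rcases hx with h0 | ⟨Y, hY, h0⟩
    · omega
    · simp only [𝒴, Finset.mem_filter, Finset.mem_univ, true_and] at hY
      have h1 := h Y hY.2.2
      rw [cutCap_erase he, if_pos ⟨hY.1, hY.2.1⟩] at h1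
      simp only [c] at h0
      omega
  have hav : x ≤ (Finset.univ.filter fun i => σ i = u).card := by
    rcases hx with h0 | ⟨Y, hY, h0⟩
    · omega
    · simp only [𝒴, Finset.mem_filter, Finset.mem_univ, true_and] at hY
      -- No edge of `S` enters `u`, so an edge leaving `Y.erase u` also leaves `Y`, and it is not
      -- `e`. The cut condition for `Y.erase u` thus shows that the excess of `Y` is made up of
      -- tokens at `u`.
      have h1 := h (Y.erase u) (by simp [hY.2.2])
      have h2 : cutCap K S (Y.erase u) ≤ c Y := by
        rw [cutCap_erase he, if_neg (by simp [← hu]), add_zero]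
        refine Finset.sum_le_sum fun f hf => ?_
        have := hin f (Finset.mem_of_mem_erase hf)
        by_cases h3 : I.tail f ∈ Y.erase u ∧ I.head f ∉ Y.erase u
        · rw [if_pos h3, if_pos ⟨Finset.mem_of_mem_erase h3.1, fun h4 =>
            h3.2 (Finset.mem_erase.2 ⟨this, h4⟩)⟩]
        · rw [if_neg h3]; exact Nat.zero_le _
      have h3 := load_erase (σ := σ) hY.1
      omega
  obtain ⟨A, hA, hAx⟩ := Finset.exists_subset_card_eq hav
  have hAu : ∀ i ∈ A, σ i = u := fun i hi => by simpa using hA hi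
  refine ⟨A, hAu, fun _ => he, fun hM => ?_, fun X hX => ?_⟩
  · rw [hAx]; simpa [capacity, hM] using hcap
  have h1 := load_move (v := v) hAu X
  have h2 := h X hX
  rw [cutCap_erase he] at h2
  by_cases huX : u ∈ X <;> by_cases hvX : v ∈ X
  · simp [huX, hvX, ← hu, ← hv] at h1 h2
    omega
  · have h3 := hle X (by simp [𝒴, huX, hvX, hX])
    simp only [huX, hvX, if_true, if_false] at h1
    simp only [c] at h3
    omega
  · simp only [huX, hvX, if_true, if_false] at h1
    simp only [← hu, ← hv, huX, hvX, false_and, if_false] at h2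
    rcases hx with h0 | ⟨Y, hY, h0⟩
    · omega
    · simp only [𝒴, Finset.mem_filter, Finset.mem_univ, true_and] at hY
      -- Here `X` gains `x` tokens. Uncross it with a set `Y` of excess `x`: neither `X ∪ Y` nor `X
      -- ∩ Y` is left by `e`, so both satisfy the cut condition without `e`, and submodularity
      -- leaves room `x` at `X`.
      have h3 := load_union_add_inter σ X Y
      have h4 := cutCap_submodular (K := K) (S.erase e) X Y
      have h5 := h (X ∪ Y) (by simp [hX, hY.2.2])
      have h6 := h (X ∩ Y) (by simp [hX])
      rw [cutCap_erase he, if_neg (by simp [← hu, ← hv, huX, hvX])] at h5 h6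
      simp only [c] at h0
      omega
  · simp [huX, hvX, ← hu, ← hv] at h1 h2
    omega

/-- A cut of capacity at most `k` contains only edges of `M`, and at most `k` of them. Letting
exactly these fail would trap every path from `s` inside `X`. -/
theorem IsFeasible.covers {k : ℕ} {S : Finset (Fin I.m)} (h : I.IsFeasible k S) :
    Covers S (fun _ : Fin (k + 1) => I.s) := by
  intro X ht
  by_cases hs : I.s ∈ X
  swap
  · simp [load, hs]
  refine (load_le _ _).trans ?_
  by_contra! hlt
  let C := S.filter fun e => I.tail e ∈ X ∧ I.head e ∉ X
  have hC : cutCap (k + 1) S X = ∑ e ∈ C, I.capacity (k + 1) e := by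
    rw [cutCap, Finset.sum_filter]
  have hCM : C ⊆ I.M := by
    intro e he
    by_contra hM
    have := Finset.single_le_sum (f := I.capacity (k + 1)) (fun _ _ => Nat.zero_le _) he
    simp only [capacity, hM, if_false] at this hC
    omega
  have hcard : C.card ≤ k := by
    have : ∑ e ∈ C, I.capacity (k + 1) e = ∑ e ∈ C, 1 :=
      Finset.sum_congr rfl fun e he => by simp [capacity, hCM he]
    simp at this
    omega
  have hpath := h C hCM hcard
  have : ∀ v, Relation.ReflTransGen (I.Adj (S \ C)) I.s v → v ∈ X := by
    intro v hv
    induction hv with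
    | refl => exact hs
    | tail _ hadj ih =>
      obtain ⟨e, he, rfl, rfl⟩ := hadj
      by_contra hX
      simp only [Finset.mem_sdiff, C, Finset.mem_filter] at he
      exact he.2 ⟨he.1, ih, hX⟩
  exact ht (this _ hpath)

/-- Apply the cut condition to the single vertex where the token sits. -/
theorem Covers.eq_t {σ : Fin K → Fin I.n} (h : Covers ∅ σ) (i : Fin K) : σ i = I.t := by
  by_contra hi
  have := h {σ i} (by simpa using Ne.symm hi)
  simp only [cutCap, Finset.sum_empty, load, Nat.le_zero, Finset.sum_eq_zero_iff] at this
  simpa using this i (Finset.mem_univ _)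

/-! ### Routings -/

theorem Adj.mono {S S' : Finset (Fin I.m)} (h : S ⊆ S') {u v : Fin I.n} (ha : I.Adj S u v) :
    I.Adj S' u v := by
  obtain ⟨e, he, h'⟩ := ha
  exact ⟨e, h he, h'⟩

/-- The tokens can be brought from `s` to the configuration `σ` along the edges of `S`, so that
each edge of `M` is used by at most one token. -/
def Routable (S : Finset (Fin I.m)) (σ : Fin K → Fin I.n) : Prop :=
  ∃ P : Fin K → Finset (Fin I.m),
    (∀ i, P i ⊆ S ∧ Relation.ReflTransGen (I.Adj (P i)) I.s (σ i)) ∧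
    ∀ i j, ∀ e ∈ P i, e ∈ P j → e ∈ I.M → i = j

/-- Pigeonhole: if every route met `F`, choosing one fault on each would inject the `k + 1` tokens
into `F`, because an edge of `M` lies on only one route. -/
theorem Routable.isFeasible {k : ℕ} {S : Finset (Fin I.m)}
    (h : Routable S (fun _ : Fin (k + 1) => I.t)) : I.IsFeasible k S := by
  classical
  obtain ⟨P, hP, hd⟩ := h
  intro F hF hk
  obtain ⟨i, hi⟩ : ∃ i, Disjoint (P i) F := by
    by_contra! hcon
    choose f hf hf' using fun i => Finset.not_disjoint_iff.1 (hcon i)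
    have hinj : Function.Injective f := fun i j hij =>
      hd i j (f i) (hf i) (hij ▸ hf j) (hF (hf' i))
    have := Finset.card_le_card_of_injOn (s := Finset.univ) (t := F) f
      (fun i _ => hf' i) hinj.injOn
    simp at this
    omega
  refine Relation.ReflTransGen.mono (fun _ _ => Adj.mono ?_) _ _ (hP i).2
  exact fun e he => Finset.mem_sdiff.2 ⟨(hP i).1 he, Finset.disjoint_left.1 hi he⟩

/-- Since `e` is new, only the tokens of `A` have it on their route, so sharing `e` is governed by
`hM` alone. -/
theorem Routable.move {S : Finset (Fin I.m)} {σ : Fin K → Fin I.n} (h : Routable S σ)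
    {e : Fin I.m} (he : e ∉ S) {A : Finset (Fin K)} (hA : ∀ i ∈ A, σ i = I.tail e)
    (hM : e ∈ I.M → A.card ≤ 1) : Routable (insert e S) (move σ A (I.head e)) := by
  classical
  obtain ⟨P, hP, hd⟩ := h
  have heP : ∀ i, e ∉ P i := fun i hi => he ((hP i).1 hi)
  refine ⟨fun i => if i ∈ A then insert e (P i) else P i, fun i => ?_, fun i j f hi hj hf => ?_⟩
  · by_cases hi : i ∈ A
    · simp only [hi, if_true, FTPInstance.move]
      refine ⟨Finset.insert_subset_insert _ (hP i).1, .tail ?_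
        ⟨e, Finset.mem_insert_self _ _, rfl, rfl⟩⟩
      rw [← hA i hi]
      exact Relation.ReflTransGen.mono (fun _ _ => Adj.mono (Finset.subset_insert _ _)) _ _ (hP i).2
    · simp only [hi, if_false, FTPInstance.move]
      exact ⟨(hP i).1.trans (Finset.subset_insert _ _), (hP i).2⟩
  · by_cases hfe : f = e
    · subst hfe
      have hiA : i ∈ A := by by_contra h; simp [h, heP] at hi
      have hjA : j ∈ A := by by_contra h; simp [h, heP] at hj
      exact Finset.card_le_one.1 (hM hf) i hiA j hjA
    · refine hd i j f ?_ ?_ hf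
      · by_cases h : i ∈ A <;> simpa [h, hfe] using hi
      · by_cases h : j ∈ A <;> simpa [h, hfe] using hj

/-! ### The dynamic program -/

variable (W : Fin I.m → ℕ) (B : ℕ)

/-- Each entry below `B` is the cost of a set of edges from `L` that routes the tokens. -/
def SoundTable (T : (Fin K → Fin I.n) → ℕ) (L : Finset (Fin I.m)) : Prop :=
  ∀ σ, T σ < B → ∃ S ⊆ L, Routable S σ ∧ T σ = ∑ e ∈ S, W e

/-- Each feasible set has a good configuration whose entry is at most the cost incurred. -/
def CompleteTable {k : ℕ} (T : (Fin (k + 1) → Fin I.n) → ℕ) (L : Finset (Fin I.m)) : Prop :=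
  ∀ S, I.IsFeasible k S → ∃ σ, T σ ≤ ∑ e ∈ S ∩ L, W e ∧ Covers (S \ L) σ

/-- The entries of `T'` below `B` come from entries of `T` by moving a nonempty set of the first
`i` tokens along `e` at cost `W e`. -/
def SoundMoves (T T' : (Fin K → Fin I.n) → ℕ) (e : Fin I.m) (i : ℕ) : Prop :=
  ∀ σ, T' σ < B → ∃ σ' A, (∀ j ∈ A, j.val < i ∧ σ' j = I.tail e) ∧
    (e ∈ I.M → A.card ≤ 1) ∧ σ = move σ' A (I.head e) ∧ T' σ = T σ' + W e

/-- The table `T'` accounts for the moves of nonempty sets of the first `i` tokens along `e`. -/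
def CompleteMoves (T T' : (Fin K → Fin I.n) → ℕ) (e : Fin I.m) (i : ℕ) : Prop :=
  ∀ σ A, A.Nonempty → (∀ j ∈ A, j.val < i ∧ σ j = I.tail e) → (e ∈ I.M → A.card ≤ 1) →
    T' (move σ A (I.head e)) ≤ T σ + W e

/-- The update of `T'` that allows token `i` to move along `e`. -/
def moveToken (T T' : (Fin K → Fin I.n) → ℕ) (e : Fin I.m) (i : Fin K)
    (σ : Fin K → Fin I.n) : ℕ :=
  if σ i = I.head e then
    min (T' σ) (min (T (Function.update σ i (I.tail e)) + W e)
      (T' (Function.update σ i (I.tail e)) + if e ∈ I.M then B else 0))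
  else T' σ

variable {W B}

theorem soundMoves_zero {T T' : (Fin K → Fin I.n) → ℕ} {e : Fin I.m} (h : ∀ σ, T' σ = B) :
    SoundMoves W B T T' e 0 := by
  intro σ hσ
  rw [h] at hσ
  omega

theorem completeMoves_zero {T T' : (Fin K → Fin I.n) → ℕ} {e : Fin I.m} :
    CompleteMoves W T T' e 0 := by
  rintro σ A ⟨j, hj⟩ h _
  have := (h j hj).1
  omega

/-- The three terms of the minimum mean that token `i` makes no move, is the first to cross and pays
`W e`, or joins earlier tokens for free. -/
theorem SoundMoves.moveToken {T T' : (Fin K → Fin I.n) → ℕ} {e : Fin I.m} {i : Fin K}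
    (h : SoundMoves W B T T' e i) : SoundMoves W B T (moveToken W B T T' e i) e (i + 1) := by
  classical
  have weaken : ∀ σ, T' σ < B → ∃ σ' A, (∀ j ∈ A, j.val < i.val + 1 ∧ σ' j = I.tail e) ∧
      (e ∈ I.M → A.card ≤ 1) ∧ σ = move σ' A (I.head e) ∧ T' σ = T σ' + W e := by
    intro σ hσ
    obtain ⟨σ', A, h1, h2⟩ := h σ hσ
    exact ⟨σ', A, fun j hj => ⟨(h1 j hj).1.trans (Nat.lt_succ_self _), (h1 j hj).2⟩, h2⟩
  intro σ hσ
  by_cases hv : σ i = I.head e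
  swap
  · simp only [FTPInstance.moveToken, hv, if_false] at hσ ⊢
    exact weaken σ hσ
  simp only [FTPInstance.moveToken, hv, if_true] at hσ ⊢
  rcases min_choice (T' σ) (min (T (Function.update σ i (I.tail e)) + W e)
      (T' (Function.update σ i (I.tail e)) + if e ∈ I.M then B else 0)) with h1 | h1
  · rw [h1] at hσ ⊢
    exact weaken σ hσ
  rw [h1] at hσ ⊢
  rcases min_choice (T (Function.update σ i (I.tail e)) + W e)
      (T' (Function.update σ i (I.tail e)) + if e ∈ I.M then B else 0) with h2 | h2
  · rw [h2]
    refine ⟨Function.update σ i (I.tail e), {i}, by simp, by simp, ?_, rfl⟩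
    ext j
    by_cases hj : j = i
    · simp [move, hj, hv]
    · simp [move, hj]
  · rw [h2] at hσ ⊢
    -- On an edge of `M` the penalty `B` makes joining as bad as infinity.
    have hM : e ∉ I.M := fun hM => by simp [hM] at hσ
    simp only [hM, if_false, add_zero] at hσ ⊢
    obtain ⟨σ', A, hA, -, h4, h5⟩ := h _ hσ
    have hi : i ∉ A := fun hi => lt_irrefl _ (hA i hi).1
    refine ⟨σ', insert i A, ?_, fun h => h.elim, ?_, h5⟩
    · intro j hj
      rcases Finset.mem_insert.1 hj with rfl | hj
      · refine ⟨Nat.lt_succ_self _, ?_⟩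
        have := congrFun h4 j
        simpa [move, hi] using this.symm
      · exact ⟨(hA j hj).1.trans (Nat.lt_succ_self _), (hA j hj).2⟩
    · ext j
      by_cases hj : j = i
      · simp [move, hj, hv]
      · have := congrFun h4 j
        simp only [Function.update_of_ne hj] at this
        simp [this, move, hj]

/-- If `i ∈ A`, it is the last mover. Undoing its move leads to `A.erase i`: when this is empty, `i`
pays for the edge, otherwise the payment is already in `T'`. -/
theorem CompleteMoves.moveToken {T T' : (Fin K → Fin I.n) → ℕ} {e : Fin I.m} {i : Fin K}
    (h : CompleteMoves W T T' e i) : CompleteMoves W T (moveToken W B T T' e i) e (i + 1) := by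
  classical
  intro σ A hne hA hM
  by_cases hi : i ∈ A
  swap
  · refine le_trans ?_ (h σ A hne (fun j hj => ⟨?_, (hA j hj).2⟩) hM)
    · simp only [FTPInstance.moveToken]
      split_ifs <;> simp
    · have h1 := (hA j hj).1
      have h2 : j.val ≠ i.val := fun h => hi (Fin.ext h ▸ hj)
      omega
  have hup : Function.update (move σ A (I.head e)) i (I.tail e) =
      move σ (A.erase i) (I.head e) := by
    ext j
    by_cases hj : j = i
    · subst hj; simp [move, (hA j hi).2]
    · simp [move, hj]
  have hmi : move σ A (I.head e) i = I.head e := by simp [move, hi]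
  simp only [FTPInstance.moveToken, hmi, if_true, hup]
  rcases (A.erase i).eq_empty_or_nonempty with h0 | h0
  · refine (min_le_right _ _).trans ((min_le_left _ _).trans ?_)
    rw [h0]
    have : move σ ∅ (I.head e) = σ := by ext; simp [move]
    rw [this]
  · have hnM : e ∉ I.M := fun h' => by
      have h1 := hM h'
      have h2 := Finset.card_erase_of_mem hi
      have h3 := h0.card_pos
      omega
    refine (min_le_right _ _).trans ((min_le_right _ _).trans ?_)
    rw [if_neg hnM, add_zero]
    refine h σ _ h0 (fun j hj => ⟨?_, (hA j (Finset.mem_of_mem_erase hj)).2⟩)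
      fun h => absurd h hnM
    have h1 := (hA j (Finset.mem_of_mem_erase hj)).1
    have h2 : j.val ≠ i.val := fun h => Finset.ne_of_mem_erase hj (Fin.ext h)
    omega

theorem SoundTable.step {T T' T₂ : (Fin K → Fin I.n) → ℕ} {L : Finset (Fin I.m)} {e : Fin I.m}
    (h : SoundTable W B T L) (he : e ∉ L) (h' : SoundMoves W B T T' e K)
    (h₂ : ∀ σ, T₂ σ = min (T σ) (T' σ)) : SoundTable W B T₂ (insert e L) := by
  intro σ hσ
  rw [h₂] at hσ ⊢
  rcases min_choice (T σ) (T' σ) with h1 | h1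
  · rw [h1] at hσ ⊢
    obtain ⟨S, hS, hr⟩ := h σ hσ
    exact ⟨S, hS.trans (Finset.subset_insert _ _), hr⟩
  · rw [h1] at hσ ⊢
    obtain ⟨σ', A, hA, hM, rfl, hc⟩ := h' σ hσ
    rw [hc] at hσ ⊢
    obtain ⟨S, hS, hr, hc'⟩ := h σ' (by omega)
    have heS : e ∉ S := fun h => he (hS h)
    refine ⟨insert e S, Finset.insert_subset_insert _ hS,
      hr.move heS (fun i hi => (hA i hi).2) hM, ?_⟩
    rw [Finset.sum_insert heS, hc', add_comm]

/-- The feasible set `S` dictates the move through `Covers.exists_move`; `hL` ensures that no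
untreated edge enters the tail. A nonempty move occurs only if `e ∈ S`, and then `S` pays `W e` as
well. -/
theorem CompleteTable.step {k : ℕ} {T T' T₂ : (Fin (k + 1) → Fin I.n) → ℕ}
    {L : Finset (Fin I.m)} {e : Fin I.m}
    (h : CompleteTable W T L) (he : e ∉ L) (h' : CompleteMoves W T T' e (k + 1))
    (hL : ∀ f, I.head f = I.tail e → f ∈ L)
    (h₂ : ∀ σ, T₂ σ = min (T σ) (T' σ)) : CompleteTable W T₂ (insert e L) := by
  intro S hS
  obtain ⟨σ, hσ, hc⟩ := h S hS
  obtain ⟨A, hA, hAS, hM, hc'⟩ := hc.exists_move e fun f hf hfe =>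
    (Finset.mem_sdiff.1 hf).2 (hL f hfe)
  refine ⟨move σ A (I.head e), ?_, ?_⟩
  · rw [h₂]
    have hsub : ∑ f ∈ S ∩ L, W f ≤ ∑ f ∈ S ∩ insert e L, W f :=
      Finset.sum_le_sum_of_subset (Finset.inter_subset_inter_left (Finset.subset_insert _ _))
    rcases A.eq_empty_or_nonempty with rfl | h0
    · have : move σ ∅ (I.head e) = σ := by ext; simp [move]
      rw [this]
      exact (min_le_left _ _).trans (hσ.trans hsub)
    · refine (min_le_right _ _).trans ((h' σ A h0 (fun j hj => ⟨j.2, hA j hj⟩) hM).trans ?_)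
      have heS : e ∈ S := (Finset.mem_sdiff.1 (hAS h0)).1
      rw [Finset.inter_insert_of_mem heS, Finset.sum_insert (by simp [he])]
      omega
  · rwa [Finset.sdiff_insert]

theorem soundTable_init {T : (Fin K → Fin I.n) → ℕ} (h0 : T (fun _ => I.s) = 0)
    (h : ∀ σ, σ ≠ (fun _ => I.s) → T σ = B) : SoundTable W B T ∅ := by
  intro σ hσ
  by_cases hs : σ = fun _ => I.s
  · subst hs
    exact ⟨∅, by simp, ⟨fun _ => ∅, fun i => ⟨by simp, .refl⟩, by simp⟩, by simp [h0]⟩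
  · rw [h σ hs] at hσ
    omega

theorem completeTable_init {k : ℕ} {T : (Fin (k + 1) → Fin I.n) → ℕ}
    (h0 : T (fun _ => I.s) = 0) : CompleteTable W T ∅ :=
  fun S hS => ⟨fun _ => I.s, by simp [h0], by simpa using hS.covers⟩

theorem SoundTable.exists_feasible {k : ℕ} {T : (Fin (k + 1) → Fin I.n) → ℕ}
    {L : Finset (Fin I.m)} (h : SoundTable W B T L) (hT : T (fun _ => I.t) < B) :
    ∃ S, I.IsFeasible k S ∧ T (fun _ => I.t) = ∑ e ∈ S, W e := by
  obtain ⟨S, -, hr, hc⟩ := h _ hT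
  exact ⟨S, hr.isFeasible, hc⟩

theorem CompleteTable.le {k : ℕ} {T : (Fin (k + 1) → Fin I.n) → ℕ}
    (h : CompleteTable W T Finset.univ) {S : Finset (Fin I.m)} (hS : I.IsFeasible k S) :
    T (fun _ => I.t) ≤ ∑ e ∈ S, W e := by
  obtain ⟨σ, hσ, hc⟩ := h S hS
  rw [Finset.sdiff_eq_empty_iff_subset.2 (Finset.subset_univ S)] at hc
  have : σ = fun _ => I.t := funext hc.eq_t
  simpa [this] using hσ

/-! ### Integral weights that encode the edge set -/

/-- The weight of `e`, scaled to an integer. -/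
def scaledWeight (I : FTPInstance) (e : Fin I.m) : ℕ :=
  ∏ f, 2 * if f = e then (I.weight f).num else (I.weight f).den

/-- The scaled weight of `e`, followed by the `e`-th unit vector in binary. -/
def codeWeight (I : FTPInstance) (e : Fin I.m) : ℕ :=
  I.scaledWeight e + 2 ^ (e : ℕ)

/-- The factor by which weights are scaled. -/
def scale (I : FTPInstance) : ℕ := ∏ f, 2 * (I.weight f).den

theorem scale_pos (I : FTPInstance) : 0 < I.scale :=
  Finset.prod_pos fun f _ => Nat.mul_pos two_pos (I.weight f).den_pos

/-- In `scale`, the denominator of `e` is replaced by its numerator, so scaling to integers needs no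
division. -/
theorem cast_scaledWeight (e : Fin I.m) :
    (I.scaledWeight e : ℚ≥0) = I.weight e * I.scale := by
  have hd : ((I.weight e).den : ℚ≥0) ≠ 0 := by exact_mod_cast (I.weight e).den_pos.ne'
  have hw : ((I.weight e).num : ℚ≥0) = I.weight e * (I.weight e).den :=
    (div_eq_iff hd).1 (NNRat.num_div_den _)
  rw [scaledWeight, scale, ← Finset.mul_prod_erase _ _ (Finset.mem_univ e),
    ← Finset.mul_prod_erase _ _ (Finset.mem_univ e)]
  have : ∏ f ∈ Finset.univ.erase e, (2 * if f = e then (I.weight f).num else (I.weight f).den) =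
      ∏ f ∈ Finset.univ.erase e, 2 * (I.weight f).den :=
    Finset.prod_congr rfl fun f hf => by rw [if_neg (Finset.ne_of_mem_erase hf)]
  rw [this, if_pos rfl]
  push_cast
  rw [hw]
  ring

theorem two_pow_dvd_scaledWeight (e : Fin I.m) : 2 ^ I.m ∣ I.scaledWeight e := by
  rw [scaledWeight, Finset.prod_mul_distrib]
  simp

theorem sum_two_pow_lt {m j : ℕ} (S : Finset (Fin m)) (h : ∀ e ∈ S, e.val < j) :
    ∑ e ∈ S, 2 ^ (e : ℕ) < 2 ^ j := by
  have := Nat.geomSum_lt (m := 2) (n := j) (s := S.map Fin.valEmbedding) le_rfl (by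
    intro e he
    obtain ⟨f, hf, rfl⟩ := Finset.mem_map.1 he
    exact h f hf)
  simpa using this

theorem sum_codeWeight (S : Finset (Fin I.m)) :
    ∑ e ∈ S, I.codeWeight e = ∑ e ∈ S, I.scaledWeight e + ∑ e ∈ S, 2 ^ (e : ℕ) :=
  Finset.sum_add_distrib

theorem sum_codeWeight_bit (S : Finset (Fin I.m)) (j : Fin I.m) :
    (∑ e ∈ S, I.codeWeight e) / 2 ^ (j : ℕ) % 2 = if j ∈ S then 1 else 0 := by
  classical
  obtain ⟨a, ha⟩ : 2 ^ (j.val + 1) ∣ ∑ e ∈ S, I.scaledWeight e :=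
    Finset.dvd_sum fun e _ => (pow_dvd_pow 2 j.2).trans (two_pow_dvd_scaledWeight e)
  obtain ⟨b, hb⟩ : 2 ^ (j.val + 1) ∣ ∑ e ∈ S with j < e, 2 ^ (e : ℕ) :=
    Finset.dvd_sum fun e he => pow_dvd_pow 2 (Fin.lt_def.1 (Finset.mem_filter.1 he).2)
  have hlt : ∑ e ∈ S with e < j, 2 ^ (e : ℕ) < 2 ^ (j : ℕ) :=
    sum_two_pow_lt _ fun e he => (Finset.mem_filter.1 he).2
  have hsplit : ∑ e ∈ S, 2 ^ (e : ℕ) = (∑ e ∈ S with e < j, 2 ^ (e : ℕ)) +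
      (if j ∈ S then 2 ^ (j : ℕ) else 0) + ∑ e ∈ S with j < e, 2 ^ (e : ℕ) := by
    rw [← Finset.sum_ite_eq S j fun e => 2 ^ (e : ℕ), Finset.sum_filter, Finset.sum_filter,
      ← Finset.sum_add_distrib, ← Finset.sum_add_distrib]
    refine Finset.sum_congr rfl fun e _ => ?_
    rcases lt_trichotomy e j with h | h | h
    · simp [h, h.ne', h.le]
    · simp [h]
    · simp [h, h.ne, h.le]
  -- Lower bits sum to less than `2 ^ j`; the scaled weights and the higher bits are multiples of `2
  -- ^ (j + 1)`.
  have : ∑ e ∈ S, I.codeWeight e = (∑ e ∈ S with e < j, 2 ^ (e : ℕ)) +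
      2 ^ (j : ℕ) * ((if j ∈ S then 1 else 0) + 2 * (a + b)) := by
    rw [sum_codeWeight, ha, hsplit, hb]
    split_ifs <;> ring
  rw [this, Nat.add_mul_div_left _ _ (by positivity), Nat.div_eq_of_lt hlt, zero_add,
    Nat.add_mul_mod_self_left]
  split_ifs <;> rfl

/-- Scaled costs are multiples of `2 ^ m`, so distinct ones differ by at least `2 ^ m`, more than
the added bits can make up for. -/
theorem cost_le_of_sum_codeWeight_le {S S' : Finset (Fin I.m)}
    (h : ∑ e ∈ S, I.codeWeight e ≤ ∑ e ∈ S', I.codeWeight e) : I.cost S ≤ I.cost S' := by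
  have key : ∑ e ∈ S, I.scaledWeight e ≤ ∑ e ∈ S', I.scaledWeight e := by
    by_contra! hlt
    obtain ⟨a, ha⟩ : 2 ^ I.m ∣ ∑ e ∈ S, I.scaledWeight e :=
      Finset.dvd_sum fun e _ => two_pow_dvd_scaledWeight e
    obtain ⟨b, hb⟩ : 2 ^ I.m ∣ ∑ e ∈ S', I.scaledWeight e :=
      Finset.dvd_sum fun e _ => two_pow_dvd_scaledWeight e
    have h1 := sum_two_pow_lt S' fun e _ => e.2
    rw [sum_codeWeight, sum_codeWeight] at h
    rw [ha, hb] at h hlt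
    have h2 : b + 1 ≤ a := Nat.lt_of_mul_lt_mul_left hlt
    have h3 := Nat.mul_le_mul_left (2 ^ I.m) h2
    rw [mul_add] at h3
    omega
  have hcost (S : Finset (Fin I.m)) :
      ((∑ e ∈ S, I.scaledWeight e : ℕ) : ℚ≥0) = I.cost S * I.scale := by
    rw [cost, Finset.sum_mul, Nat.cast_sum]
    exact Finset.sum_congr rfl fun e _ => cast_scaledWeight e
  have h1 : ((∑ e ∈ S, I.scaledWeight e : ℕ) : ℚ≥0) ≤ (∑ e ∈ S', I.scaledWeight e : ℕ) := by
    exact_mod_cast key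
  rw [hcost, hcost] at h1
  exact le_of_mul_le_mul_right h1 (by exact_mod_cast I.scale_pos)

end FTPInstance

namespace RAM

variable {σ : Store}

/-! ### Arithmetic -/

/-- Multiplication of the registers `50` and `51`; the result is in register `52`. -/
def mulProg : Prog :=
  .seq (.const 52 0) <| .loop 51 <| .seq (.half 53 51) <| .seq (.add 53 53 53) <|
    .seq (.sub 53 51 53) <| .seq (.ite 53 (.add 52 52 50) (.const 53 0)) <|
      .seq (.add 50 50 50) (.half 51 51)

def mulTime (Z : ℕ) : ℕ := Z * 8 + 2

theorem size_half_lt {y : ℕ} (hy : y ≠ 0) : (y / 2).size < y.size := by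
  have hs : 0 < y.size := Nat.size_pos.2 (Nat.pos_of_ne_zero hy)
  have h2 : y < 2 ^ (y.size - 1 + 1) := by
    rw [Nat.sub_add_cancel hs]; exact Nat.lt_size_self y
  have : (y / 2).size ≤ y.size - 1 := Nat.size_le.2 (by rw [pow_succ] at h2; omega)
  omega

/-- Binary shift-and-add. The time depends only on the bit length of register `51`, so register `50`
may hold a huge partial product. -/
theorem runs_mulProg {Z : ℕ} (hZ : (σ.reg 51).size ≤ Z) :
    Runs mulProg σ fun t τ => t ≤ mulTime Z ∧ Frame 50 σ τ ∧ τ.arr = σ.arr ∧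
      τ.reg 52 = σ.reg 50 * σ.reg 51 := by
  simp only [mulProg, runs_seq, runs_const]
  refine (runs_loop (T := 7) (fun τ => Frame 50 σ τ ∧ τ.arr = σ.arr ∧
    τ.reg 52 + τ.reg 50 * τ.reg 51 = σ.reg 50 * σ.reg 51) (fun τ => (τ.reg 51).size)
    ?_ Z _ ?_ ?_).mono ?_
  · rintro τ ⟨hf, ha, hm⟩ hx
    have hsz := size_half_lt hx
    simp only [runs_seq, runs_half, runs_add, runs_sub]
    have hdm := Nat.div_add_mod (τ.reg 51) 2
    refine runs_ite (fun hb => ?_) (fun hb => ?_)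
    · simp at hb
      have h1 : τ.reg 51 = 2 * (τ.reg 51 / 2) + 1 := by omega
      simp [hf, ha, hsz]
      rw [← hm]
      conv_rhs => rw [h1]
      ring
    · simp at hb
      have h1 : τ.reg 51 = 2 * (τ.reg 51 / 2) := by omega
      simp [hf, ha, hsz]
      rw [← hm]
      conv_rhs => rw [h1]
      ring
  · simp [Frame.refl]
  · simpa using hZ
  · rintro t τ ⟨ht, ⟨hf, ha, hm⟩, hx⟩
    refine ⟨by simp only [mulTime]; omega, hf, ha, by simpa [hx] using hm⟩

/-- Division of register `50` by register `51`; the quotient is in register `52` and the remainder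
in register `50`. -/
def divProg : Prog :=
  .seq (.const 52 0) <| .seq (.const 54 1) <| .seq (.add 55 50 54) <| .seq (.sub 55 55 51) <|
    .loop 55 <| .seq (.sub 50 50 51) <| .seq (.add 52 52 54) <| .seq (.add 55 50 54) <|
      .sub 55 55 51

def divTime (Z : ℕ) : ℕ := Z * 5 + 5

/-- Repeated subtraction is affordable because the dividends will be at most the number of
configurations. Register `55` is nonzero exactly while the remainder is at least the divisor. -/
theorem runs_divProg {Z : ℕ} (hZ : σ.reg 50 ≤ Z) (hy : 0 < σ.reg 51) :
    Runs divProg σ fun t τ => t ≤ divTime Z ∧ Frame 50 σ τ ∧ τ.arr = σ.arr ∧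
      τ.reg 52 = σ.reg 50 / σ.reg 51 ∧ τ.reg 50 = σ.reg 50 % σ.reg 51 := by
  simp only [divProg, runs_seq, runs_const, runs_add, runs_sub]
  refine (runs_loop (T := 4) (fun τ => Frame 50 σ τ ∧ τ.arr = σ.arr ∧ τ.reg 51 = σ.reg 51 ∧
    τ.reg 54 = 1 ∧ τ.reg 55 = τ.reg 50 + 1 - σ.reg 51 ∧
    τ.reg 50 + σ.reg 51 * τ.reg 52 = σ.reg 50) (fun τ => τ.reg 50)
    ?_ Z _ ?_ ?_).mono ?_
  · rintro τ ⟨hf, ha, h51, h54, h55, hm⟩ hx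
    simp [hf, ha, h51, h54, mul_add]
    omega
  · simp [Frame.refl]
  · simpa using hZ
  · rintro t τ ⟨ht, ⟨hf, ha, h51, h54, h55, hm⟩, hx⟩
    obtain ⟨h1, h2⟩ := (Nat.div_mod_unique (a := σ.reg 50) (c := τ.reg 50) (d := τ.reg 52) hy).2
      ⟨hm, by omega⟩
    exact ⟨by simp only [divTime]; omega, hf, ha, h1.symm, h2.symm⟩

end RAM

namespace FTPInstance

open RAM

variable {I : FTPInstance} {σ τ : Store}

/-! ### The instance in memory and the common iteration bound. -/

@[simp] theorem toArray_val {m : ℕ} (f : Fin m → ℕ) (e : Fin m) : toArray f e = f e := by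
  simp [toArray]

/-- The store still contains the instance. -/
structure Loaded (I : FTPInstance) (σ : Store) : Prop where
  n : σ.reg 0 = I.n
  m : σ.reg 1 = I.m
  s : σ.reg 2 = I.s
  t : σ.reg 3 = I.t
  tail : ∀ e, σ.arr 0 (e : Fin I.m) = I.tail e
  head : ∀ e, σ.arr 1 (e : Fin I.m) = I.head e
  num : ∀ e, σ.arr 2 (e : Fin I.m) = (I.weight e).num
  den : ∀ e, σ.arr 3 (e : Fin I.m) = (I.weight e).den
  fault : ∀ e, σ.arr 4 (e : Fin I.m) = if e ∈ I.M then 1 else 0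

theorem loaded_input (I : FTPInstance) : I.Loaded I.input := by
  constructor <;> simp [input]

theorem Loaded.mono (h : I.Loaded σ) (hf : Frame 4 σ τ) (ha : ∀ a < 5, τ.arr a = σ.arr a) :
    I.Loaded τ := by
  obtain ⟨h0, h1, h2, h3, h4, h5, h6, h7, h8⟩ := h
  constructor
  · rwa [hf _ (by norm_num)]
  · rwa [hf _ (by norm_num)]
  · rwa [hf _ (by norm_num)]
  · rwa [hf _ (by norm_num)]
  all_goals rwa [ha _ (by norm_num)]

/-- A common bound for the numbers of iterations. -/
structure Bound (I : FTPInstance) (k Z : ℕ) : Prop where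
  n : I.n ≤ Z
  m : I.m ≤ Z
  tokens : k + 1 ≤ Z
  pow : I.n ^ (k + 1) ≤ Z
  num : ∀ e, (I.weight e).num.size ≤ Z
  den : ∀ e, (I.weight e).den.size ≤ Z

theorem n_pos (I : FTPInstance) : 0 < I.n := I.s.pos

/-! ### Ranks -/

/-- Array `5` receives, for each vertex, a rank that increases along the edges. -/
def rankProg : Prog :=
  .seq (.const 20 1) <| .loop 20 <| .seq (.const 20 0) <| forLoop 22 1 <|
    .seq (.load 24 0 22) <| .seq (.load 25 1 22) <| .seq (.load 26 5 24) <|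
      .seq (.load 27 5 25) <| .seq (.const 28 1) <| .seq (.add 28 26 28) <|
        .seq (.sub 29 28 27) <|
          .ite 29 (.seq (.store 5 25 28) (.const 20 1)) (.const 29 0)

def rankTime (Z : ℕ) : ℕ := (Z * Z + 1) * (Z * (10 + 4) + 5) + 2

theorem runs_rankProg {k Z : ℕ} (hI : I.IsAcyclic) (hZ : I.Bound k Z) (h : I.Loaded σ)
    (h5 : σ.arr 5 = fun _ => 0) :
    Runs rankProg σ fun t τ => t ≤ rankTime Z ∧ Frame 20 σ τ ∧
      (∀ a ≠ 5, τ.arr a = σ.arr a) ∧ (∀ v : Fin I.n, τ.arr 5 v < I.n) ∧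
      ∀ e, τ.arr 5 (I.tail e) < τ.arr 5 (I.head e) := by
  obtain ⟨R, hRn, hR⟩ := I.exists_rank hI
  let gap : (ℕ → ℕ) → ℕ := fun f => ∑ v : Fin I.n, (R v - f v)
  simp only [rankProg, runs_seq, runs_const]
  -- Ranks are raised along violated edges until a pass changes nothing. They stay below the
  -- ancestor count `R`, so every changing pass lowers `gap`; adding the flag in register `20` makes
  -- the measure drop in the final, unchanging pass too.
  refine (runs_loop (T := Z * (10 + 4) + 4) (fun τ => Frame 20 σ τ ∧ (∀ a ≠ 5, τ.arr a = σ.arr a) ∧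
    (∀ v : Fin I.n, τ.arr 5 v ≤ R v) ∧
    (τ.reg 20 = 0 → ∀ e, τ.arr 5 (I.tail e) < τ.arr 5 (I.head e)))
    (fun τ => gap (τ.arr 5) + τ.reg 20) ?_ (Z * Z + 1) _ ?_ ?_).mono ?_
  · rintro τ ⟨hf, ha, hle, -⟩ hx
    simp only [runs_seq, runs_const]
    refine (runs_forLoop (T := 10) (L := I.m) (Z := Z) (fun j υ => Frame 20 σ υ ∧
      (∀ a ≠ 5, υ.arr a = σ.arr a) ∧ (∀ v : Fin I.n, υ.arr 5 v ≤ R v) ∧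
      ((υ.reg 20 = 0 ∧ υ.arr 5 = τ.arr 5 ∧
          ∀ e : Fin I.m, e.val < j → υ.arr 5 (I.tail e) < υ.arr 5 (I.head e)) ∨
        (υ.reg 20 = 1 ∧ gap (υ.arr 5) < gap (τ.arr 5)))) (by norm_num) ?_ hZ.m ?_ ?_ ?_).mono ?_
    · simp [hf 1, h.m]
    · rintro j υ υ' ⟨h1, h2, h3, h4⟩ hfr har
      refine ⟨h1.trans hfr (by norm_num), by simpa [har] using h2, by simpa [har] using h3, ?_⟩
      rw [har, hfr 20 (by norm_num)]
      exact h4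
    · refine ⟨by simpa using hf, by simpa using ha, by simpa using hle, .inl ?_⟩
      simp
    · rintro j hj υ ⟨h1, h2, h3, h4⟩ h22 hl
      let e : Fin I.m := ⟨j, hj⟩
      have hu : υ.arr 0 j = I.tail e := by rw [h2 0 (by norm_num)]; exact h.tail e
      have hv : υ.arr 1 j = I.head e := by rw [h2 1 (by norm_num)]; exact h.head e
      simp only [runs_seq, runs_const, runs_load, runs_add, runs_sub]
      refine runs_ite (fun hb => ?_) (fun hb => ?_)
      · simp [h22, hu, hv] at hb
        simp [h22, hu, hv, h1, hl]
        have hgap : gap (Function.update (υ.arr 5) (I.head e) (υ.arr 5 (I.tail e) + 1)) <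
            gap (υ.arr 5) := by
          have hRe := hR e
          have hle := h3 (I.tail e)
          refine Finset.sum_lt_sum (fun v _ => ?_) ⟨I.head e, Finset.mem_univ _, ?_⟩
          · by_cases hv : v = I.head e
            · subst hv; simp; omega
            · rw [Function.update_of_ne (by simpa [Fin.ext_iff] using hv)]
          · simp; omega
        refine ⟨fun a ha => ?_, fun v => ?_, ?_⟩
        · rw [arr_setArr_of_ne _ _ _ ha]; exact h2 a ha
        · by_cases hv : v = I.head e
          · subst hv
            simp only [Function.update_self]
            have := hR e
            have := h3 (I.tail e)
            omega
          · rw [Function.update_of_ne (by simpa [Fin.ext_iff] using hv)]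
            exact h3 v
        · rcases h4 with ⟨-, h4, -⟩ | ⟨-, h4⟩
          · rwa [h4] at hgap ⊢
          · omega
      · simp [h22, hu, hv] at hb
        simp [h22, h1, hl]
        refine ⟨h2, h3, ?_⟩
        rcases h4 with ⟨h4, h6, h7⟩ | h4
        · refine .inl ⟨h4, h6, fun f hf => ?_⟩
          rcases Nat.lt_or_eq_of_le hf with hf | hf
          · exact h7 f hf
          · have : f = e := Fin.ext hf
            subst this
            omega
        · exact .inr h4
    · rintro t υ ⟨ht, h1, h2, h3, h4⟩
      refine ⟨by omega, ⟨h1, h2, h3, ?_⟩, ?_⟩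
      · rcases h4 with ⟨-, -, h4⟩ | ⟨h4, -⟩
        · exact fun _ e => h4 e e.2
        · omega
      · rcases h4 with ⟨h4, h6, -⟩ | ⟨h4, h6⟩
        · rw [h4, h6]; omega
        · rw [h4]; omega
  · simp [Frame.refl, h5]
  · simp only [arr_setReg, h5, gap, reg_setReg, if_true, Nat.sub_zero]
    have : ∑ v, R v ≤ I.n * I.n := by
      refine (Finset.sum_le_card_nsmul _ _ I.n fun v _ => (hRn v).le).trans (by simp)
    have := Nat.mul_le_mul hZ.n hZ.n
    omega
  · rintro t τ ⟨ht, ⟨h1, h2, h3, h4⟩, hx⟩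
    refine ⟨?_, h1, h2, fun v => (h3 v).trans_lt (hRn v), h4 hx⟩
    simp only [rankTime]
    linarith

/-! ### Weights -/

theorem prod_fin_lt_succ {m j : ℕ} (F : Fin m → ℕ) (hj : j < m) :
    (∏ f : Fin m, if f.val < j + 1 then F f else 1) =
      (∏ f : Fin m, if f.val < j then F f else 1) * F ⟨j, hj⟩ := by
  simp only [← Finset.prod_filter]
  rw [mul_comm, ← Finset.prod_insert (a := (⟨j, hj⟩ : Fin m)) (by simp)]
  refine Finset.prod_congr ?_ fun _ _ => rfl
  ext f
  simp [Fin.ext_iff]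
  omega

theorem sum_fin_lt_succ {m j : ℕ} (F : Fin m → ℕ) (hj : j < m) :
    (∑ f : Fin m, if f.val < j + 1 then F f else 0) =
      (∑ f : Fin m, if f.val < j then F f else 0) + F ⟨j, hj⟩ := by
  simp only [← Finset.sum_filter]
  rw [add_comm _ (F _), ← Finset.sum_insert (a := (⟨j, hj⟩ : Fin m)) (by simp)]
  refine Finset.sum_congr ?_ fun _ _ => rfl
  ext f
  simp [Fin.ext_iff]
  omega

/-- Array `6` receives the weights `codeWeight`, register `4` a bound for their sums. -/
def weightProg : Prog :=
  .seq (.const 4 1) <| .seq (.const 20 1) <| forLoop 22 1 <|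
    .seq (.const 24 1) <| .seq
      (forLoop 26 1 <| .seq (.sub 28 22 26) <| .seq (.sub 29 26 22) <| .seq (.add 28 28 29) <|
        .seq (.ite 28 (.load 51 3 26) (.load 51 2 26)) <| .seq (.add 50 24 24) <|
          .seq mulProg <| copy 24 52) <|
      .seq (.add 24 24 20) <| .seq (.store 6 22 24) <| .seq (.add 20 20 20) <| .add 4 4 24

def weightTime (Z : ℕ) : ℕ := Z * (Z * (mulTime Z + 8 + 4) + 3 + 5 + 4) + 3 + 2

/-- A strict upper bound for the scaled cost of every edge set. -/
def costBound (I : FTPInstance) : ℕ := 1 + ∑ e, I.codeWeight e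

theorem runs_weightProg {k Z : ℕ} (hZ : I.Bound k Z) (h : I.Loaded σ) :
    Runs weightProg σ fun t τ => t ≤ weightTime Z ∧ Frame 4 σ τ ∧
      (∀ a ≠ 6, τ.arr a = σ.arr a) ∧ (∀ e : Fin I.m, τ.arr 6 e = I.codeWeight e) ∧
      τ.reg 4 = I.costBound := by
  simp only [weightProg, runs_seq, runs_const]
  refine (runs_forLoop (T := Z * (mulTime Z + 8 + 4) + 3 + 5) (L := I.m) (Z := Z) (fun j υ =>
    Frame 4 σ υ ∧ (∀ a ≠ 6, υ.arr a = σ.arr a) ∧ υ.reg 20 = 2 ^ j ∧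
    (∀ e : Fin I.m, e.val < j → υ.arr 6 e = I.codeWeight e) ∧
    υ.reg 4 = 1 + ∑ e : Fin I.m, if e.val < j then I.codeWeight e else 0)
    (by norm_num) ?_ hZ.m ?_ ?_ ?_).mono ?_
  · simp [h.m]
  · rintro j υ υ' ⟨h1, h2, h3, h4, h6⟩ hfr har
    refine ⟨h1.trans hfr (by norm_num), by simpa [har] using h2, ?_, by simpa [har] using h4, ?_⟩
    · rw [hfr _ (by norm_num), h3]
    · rw [hfr _ (by norm_num), h6]
  · simp [Frame.refl]
  · rintro j hj υ ⟨h1, h2, h3, h4, h6⟩ h22 hl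
    let e : Fin I.m := ⟨j, hj⟩
    simp only [runs_seq, runs_const]
    refine (runs_forLoop (T := mulTime Z + 8) (L := I.m) (Z := Z) (fun i ρ =>
      Frame 24 υ ρ ∧ ρ.arr = υ.arr ∧ ρ.reg 24 = ∏ f : Fin I.m,
        if f.val < i then 2 * (if f = e then (I.weight f).num else (I.weight f).den) else 1)
      (by norm_num) ?_ hZ.m ?_ ?_ ?_).mono ?_
    · simp [hl]
    · rintro i ρ ρ' ⟨g1, g2, g3⟩ hfr har
      exact ⟨g1.trans hfr (by norm_num), har.trans g2, by rw [hfr _ (by norm_num), g3]⟩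
    · simp [Frame.refl]
    · rintro i hi ρ ⟨g1, g2, g3⟩ g26 gl
      let f : Fin I.m := ⟨i, hi⟩
      have g22 : ρ.reg 22 = j := by rw [g1 _ (by norm_num), h22]
      have gnum : ρ.arr 2 i = (I.weight f).num := by
        rw [g2, h2 2 (by norm_num)]; exact h.num f
      have gden : ρ.arr 3 i = (I.weight f).den := by
        rw [g2, h2 3 (by norm_num)]; exact h.den f
      have hprod : (∏ f : Fin I.m, if f.val < i + 1 then
          2 * (if f = e then (I.weight f).num else (I.weight f).den) else 1) =
          (∏ f : Fin I.m, if f.val < i then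
          2 * (if f = e then (I.weight f).num else (I.weight f).den) else 1) *
          (2 * if f = e then (I.weight f).num else (I.weight f).den) := by
        exact prod_fin_lt_succ (fun f => 2 * if f = e then (I.weight f).num else (I.weight f).den) hi
      -- Common tail of the two branches, which differ only in whether a numerator or a denominator
      -- is loaded. The factor `2` comes from doubling register `24` into register `50`.
      have finish : ∀ (ρ' : Store) (s : ℕ), s ≤ 6 → Frame 26 ρ ρ' → ρ'.arr = ρ.arr →
          ρ'.reg 51 = (if f = e then (I.weight f).num else (I.weight f).den) →
          ρ'.reg 50 = ρ.reg 24 + ρ.reg 24 → ρ'.reg 26 = i →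
          Runs mulProg ρ' fun t ω => Runs (copy 24 52) ω fun u ω' => s + (t + u) ≤ mulTime Z + 8 ∧
            ω'.reg 26 = i ∧ ω'.reg 1 = I.m ∧ Frame 24 υ ω' ∧ ω'.arr = υ.arr ∧
            ω'.reg 24 = ∏ f : Fin I.m, if f.val < i + 1 then
              2 * (if f = e then (I.weight f).num else (I.weight f).den) else 1 := by
        intro ρ' s hs hfr har h51 h50 h26
        have hsz : (ρ'.reg 51).size ≤ Z := by
          rw [h51]; split_ifs
          · exact hZ.num _
          · exact hZ.den _
        refine (runs_mulProg hsz).mono ?_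
        rintro t ω ⟨ht, w1, w2, w3⟩
        rw [runs_copy (by norm_num)]
        refine ⟨by omega, ?_, ?_, ?_, ?_, ?_⟩
        · simp [w1 26, h26]
        · simp [w1 1, hfr 1, gl]
        · rw [frame_setReg (by norm_num)]
          exact (g1.trans hfr (by norm_num)).trans w1 (by norm_num)
        · simp [w2, har, g2]
        · rw [hprod, ← g3]
          simp [w3, h51, h50]
          ring_nf
      simp only [runs_seq, runs_sub, runs_add]
      refine runs_ite (fun hb => ?_) (fun hb => ?_)
      · simp [g26, g22] at hb
        have hfe : f ≠ e := fun hfe => by have := Fin.ext_iff.1 hfe; simp [f, e] at this; omega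
        simp only [runs_load]
        refine (finish _ 6 le_rfl ?_ ?_ ?_ ?_ ?_).mono ?_
        · simp [Frame.refl]
        · simp
        · simp [g26, gden, hfe]
        · simp
        · simp [g26]
        · intro t ω hω
          exact hω.mono fun u ω' hω' => ⟨by have := hω'.1; omega, hω'.2⟩
      · simp [g26, g22] at hb
        have hfe : f = e := Fin.ext (by simp [f, e]; omega)
        simp only [runs_load]
        refine (finish _ 6 le_rfl ?_ ?_ ?_ ?_ ?_).mono ?_
        · simp [Frame.refl]
        · simp
        · simp [g26, gnum, hfe]
        · simp
        · simp [g26]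
        · intro t ω hω
          exact hω.mono fun u ω' hω' => ⟨by have := hω'.1; omega, hω'.2⟩
    · rintro t ρ ⟨ht, g1, g2, g3⟩
      have g20 : ρ.reg 20 = 2 ^ j := by rw [g1 _ (by norm_num), h3]
      have g22 : ρ.reg 22 = j := by rw [g1 _ (by norm_num), h22]
      have g4 := g1 4 (by norm_num)
      have gc : ρ.reg 24 + 2 ^ j = I.codeWeight e := by
        rw [g3]; simp [codeWeight, scaledWeight, e]
      simp [g20, g22, g4, gc, g1 1, hl]
      refine ⟨by omega, h1.trans g1 (by norm_num), ?_, ?_, ?_, ?_⟩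
      · intro a ha
        rw [arr_setArr_of_ne _ _ _ ha]
        simpa [g2] using h2 a ha
      · ring
      · intro f hf
        by_cases hfe : f = e
        · subst hfe; simp [e]
        · have : f.val ≠ j := fun h => hfe (Fin.ext h)
          rw [Function.update_of_ne this, g2]
          exact h4 f (by omega)
      · have := sum_fin_lt_succ I.codeWeight hj
        simp only [Order.lt_add_one_iff] at this
        rw [this, h6, add_assoc]
  · rintro t τ ⟨ht, h1, h2, h3, h4, h6⟩
    refine ⟨by simp only [weightTime]; omega, h1, h2, fun e => h4 e e.2, ?_⟩
    simpa [costBound] using h6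

/-! ### Numbering the configurations -/

/-- The number of a configuration. -/
def code {K : ℕ} (c : Fin K → Fin I.n) : ℕ := finFunctionFinEquiv c

theorem code_eq {K : ℕ} (c : Fin K → Fin I.n) : code c = ∑ i, (c i : ℕ) * I.n ^ (i : ℕ) := rfl

theorem code_lt {K : ℕ} (c : Fin K → Fin I.n) : code c < I.n ^ K := (finFunctionFinEquiv c).2

theorem code_inj {K : ℕ} {c d : Fin K → Fin I.n} : code c = code d ↔ c = d := by
  rw [code, code, ← Fin.ext_iff, Equiv.apply_eq_iff_eq]

theorem exists_code {K j : ℕ} (hj : j < I.n ^ K) : ∃ c : Fin K → Fin I.n, code c = j :=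
  ⟨finFunctionFinEquiv.symm ⟨j, hj⟩, by simp [code]⟩

theorem code_digit {K : ℕ} (c : Fin K → Fin I.n) (i : Fin K) :
    code c / I.n ^ (i : ℕ) % I.n = c i := by
  have := congrFun (finFunctionFinEquiv.symm_apply_apply c) i
  rw [Fin.ext_iff, finFunctionFinEquiv_symm_apply_val] at this
  exact this

/-- A configuration number is written in base `n` with one digit per token, so a move changes it by
two multiples of a power of `n`. The additive form avoids truncated subtraction. -/
theorem code_update {K : ℕ} (c : Fin K → Fin I.n) (i : Fin K) (u : Fin I.n) :
    code (Function.update c i u) + c i * I.n ^ (i : ℕ) = code c + u * I.n ^ (i : ℕ) := by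
  rw [code_eq, code_eq, ← Finset.add_sum_erase _ _ (Finset.mem_univ i),
    ← Finset.add_sum_erase Finset.univ (fun i => (c i : ℕ) * I.n ^ (i : ℕ)) (Finset.mem_univ i)]
  have : ∑ j ∈ Finset.univ.erase i, (Function.update c i u j : ℕ) * I.n ^ (j : ℕ) =
      ∑ j ∈ Finset.univ.erase i, (c j : ℕ) * I.n ^ (j : ℕ) :=
    Finset.sum_congr rfl fun j hj => by rw [Function.update_of_ne (Finset.ne_of_mem_erase hj)]
  rw [this, Function.update_self]
  ring

theorem code_const (K : ℕ) (v : Fin I.n) :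
    code (fun _ : Fin K => v) = ∑ i ∈ Finset.range K, (v : ℕ) * I.n ^ i := by
  rw [code_eq, Finset.sum_range]

theorem Bound.pow_le {k Z j : ℕ} (hZ : I.Bound k Z) (hj : j ≤ k + 1) : I.n ^ j ≤ Z :=
  (Nat.pow_le_pow_right I.n_pos hj).trans hZ.pow

theorem size_le_self (n : ℕ) : n.size ≤ n := Nat.size_le.2 Nat.lt_two_pow_self

/-- Registers `5`, `6`, `7`, `8` receive the number of configurations, the numbers of the
configurations with all tokens in `s` and with all tokens in `t`, and the number of tokens. -/
def codeProg (k : ℕ) : Prog :=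
  .seq (.const 8 (k + 1)) <| .seq (.const 5 1) <| .seq (.const 6 0) <| .seq (.const 7 0) <|
    forLoop 22 8 <| .seq (copy 50 2) <| .seq (copy 51 5) <| .seq mulProg <|
      .seq (.add 6 6 52) <| .seq (copy 50 3) <| .seq (copy 51 5) <| .seq mulProg <|
        .seq (.add 7 7 52) <| .seq (copy 50 0) <| .seq (copy 51 5) <| .seq mulProg <| copy 5 52

def codeTime (Z : ℕ) : ℕ := Z * (3 * mulTime Z + 16 + 4) + 3 + 4

theorem runs_codeProg {k Z : ℕ} (hZ : I.Bound k Z) (h : I.Loaded σ) :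
    Runs (codeProg k) σ fun t τ => t ≤ codeTime Z ∧ Frame 5 σ τ ∧ τ.arr = σ.arr ∧
      τ.reg 5 = I.n ^ (k + 1) ∧ τ.reg 6 = code (fun _ : Fin (k + 1) => I.s) ∧
      τ.reg 7 = code (fun _ : Fin (k + 1) => I.t) ∧ τ.reg 8 = k + 1 := by
  simp only [codeProg, runs_seq, runs_const]
  refine (runs_forLoop (T := 3 * mulTime Z + 16) (L := k + 1) (Z := Z) (fun j υ =>
    Frame 5 σ υ ∧ υ.arr = σ.arr ∧ υ.reg 5 = I.n ^ j ∧
    υ.reg 6 = ∑ i ∈ Finset.range j, (I.s : ℕ) * I.n ^ i ∧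
    υ.reg 7 = ∑ i ∈ Finset.range j, (I.t : ℕ) * I.n ^ i ∧ υ.reg 8 = k + 1)
    (by norm_num) ?_ hZ.tokens ?_ ?_ ?_).mono ?_
  · simp
  · rintro j υ υ' ⟨h1, h2, h3, h4, h5, h6⟩ hfr har
    refine ⟨h1.trans hfr (by norm_num), har.trans h2, ?_, ?_, ?_, ?_⟩
    all_goals rw [hfr _ (by norm_num)]; assumption
  · simp [Frame.refl]
  · rintro j hj υ ⟨h1, h2, h3, h4, h5, h6⟩ h22 -
    have hsz : (I.n ^ j).size ≤ Z := (size_le_self _).trans (hZ.pow_le hj.le)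
    have h0 : υ.reg 0 = I.n := by rw [h1 _ (by norm_num), h.n]
    have hs : υ.reg 2 = I.s := by rw [h1 _ (by norm_num), h.s]
    have ht : υ.reg 3 = I.t := by rw [h1 _ (by norm_num), h.t]
    simp only [runs_seq, runs_copy, runs_add, ne_eq, not_false_eq_true,
      Nat.reduceEqDiff, OfNat.zero_ne_ofNat]
    refine (runs_mulProg (by simpa [h3] using hsz)).mono ?_
    rintro t1 ρ ⟨ht1, f1, a1, m1⟩
    simp [h3, hs] at f1 a1 m1
    refine (runs_mulProg (by simpa [f1 5, h3] using hsz)).mono ?_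
    rintro t2 ρ2 ⟨ht2, f2, a2, m2⟩
    simp [f1 5, f1 3, h3, ht] at f2 a2 m2
    refine (runs_mulProg (by simpa [f1 5, f2 5, h3] using hsz)).mono ?_
    rintro t3 ρ3 ⟨ht3, f3, a3, m3⟩
    simp [f1 5, f1 0, f2 5, f2 0, h3, h0] at f3 a3 m3
    simp [a3, a2, a1, h2, f3 22, f3 8, f2 8, f1 8, f2 22, f1 22, h22, h6, f3 6, f3 7,
      f2 6, f2 7, f1 6, f1 7, h4, h5, m1, m2, m3, Finset.sum_range_succ]
    refine ⟨by omega, ?_, by ring⟩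
    refine fun r hr => ?_
    have hr' : r ≠ 6 ∧ r ≠ 7 ∧ r ≠ 50 ∧ r ≠ 51 := by omega
    rw [f3 r (by omega)]
    simp only [reg_setReg, hr', if_false]
    rw [f2 r (by omega)]
    simp only [reg_setReg, hr', if_false]
    rw [f1 r (by omega)]
    simp only [reg_setReg, hr', if_false]
    exact h1 r hr
  · rintro t τ ⟨ht, h1, h2, h3, h4, h5, h6⟩
    exact ⟨by simp only [codeTime]; omega, h1, h2, h3, by rw [h4, code_const],
      by rw [h5, code_const], h6⟩

/-! ### Preparations and the initial table. -/

/-- Array `a` receives the value of register `4` in all cells that number configurations. -/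
def fillProg (a : ℕ) : Prog := forLoop 30 5 (.store a 30 4)

def fillTime (Z : ℕ) : ℕ := Z * (1 + 4) + 3

theorem runs_fillProg {a L Z : ℕ} (hL : σ.reg 5 = L) (hZ : L ≤ Z) :
    Runs (fillProg a) σ fun t τ => t ≤ fillTime Z ∧ Frame 30 σ τ ∧
      (∀ b ≠ a, τ.arr b = σ.arr b) ∧ ∀ j < L, τ.arr a j = σ.reg 4 := by
  refine (runs_forLoop (T := 1) (L := L) (Z := Z) (fun j υ =>
    Frame 30 σ υ ∧ (∀ b ≠ a, υ.arr b = σ.arr b) ∧ ∀ i < j, υ.arr a i = σ.reg 4)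
    (by norm_num) hL hZ ?_ ?_ ?_).mono fun t τ h => h
  · rintro j υ υ' ⟨h1, h2, h3⟩ hfr har
    exact ⟨h1.trans hfr (by norm_num), by simpa [har] using h2, by simpa [har] using h3⟩
  · simp [Frame.refl]
  · rintro j hj υ ⟨h1, h2, h3⟩ h30 h5
    simp [h30, h5, h1, h1 4]
    refine ⟨fun b hb => by rw [arr_setArr_of_ne _ _ _ hb]; exact h2 b hb, fun i hi => ?_⟩
    rcases Nat.lt_or_eq_of_le hi with hi | rfl
    · rw [Function.update_of_ne hi.ne]; exact h3 i hi
    · simp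

/-- The store holds the data computed before the dynamic program starts. -/
structure Prepared (I : FTPInstance) (k : ℕ) (σ : Store) : Prop where
  loaded : I.Loaded σ
  bound : σ.reg 4 = I.costBound
  configs : σ.reg 5 = I.n ^ (k + 1)
  source : σ.reg 6 = code (fun _ : Fin (k + 1) => I.s)
  target : σ.reg 7 = code (fun _ : Fin (k + 1) => I.t)
  tokens : σ.reg 8 = k + 1
  weight : ∀ e : Fin I.m, σ.arr 6 e = I.codeWeight e
  rank_lt : ∀ v : Fin I.n, σ.arr 5 v < I.n
  rank : ∀ e, σ.arr 5 (I.tail e) < σ.arr 5 (I.head e)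

theorem Prepared.mono {k : ℕ} (h : I.Prepared k σ) (hf : Frame 20 σ τ)
    (ha : ∀ a < 7, τ.arr a = σ.arr a) : I.Prepared k τ := by
  obtain ⟨h0, h1, h2, h3, h4, h5, h6, h7, h8⟩ := h
  constructor
  · exact h0.mono (hf.mono (by norm_num)) fun a h => ha a (by omega)
  · rwa [hf _ (by norm_num)]
  · rwa [hf _ (by norm_num)]
  · rwa [hf _ (by norm_num)]
  · rwa [hf _ (by norm_num)]
  · rwa [hf _ (by norm_num)]
  all_goals rwa [ha _ (by norm_num)]

/-- The table stored in array `a`. -/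
def table (I : FTPInstance) (K : ℕ) (σ : Store) (a : ℕ) (c : Fin K → Fin I.n) : ℕ :=
  σ.arr a (code c)

/-- All preparations, and the initial table in array `7`. -/
def prepareProg (k : ℕ) : Prog :=
  .seq rankProg <| .seq weightProg <| .seq (codeProg k) <| .seq (fillProg 7) <|
    .seq (.const 20 0) (.store 7 6 20)

def prepareTime (Z : ℕ) : ℕ := rankTime Z + weightTime Z + codeTime Z + fillTime Z + 2

theorem runs_prepareProg {k Z : ℕ} (hI : I.IsAcyclic) (hZ : I.Bound k Z) :
    Runs (prepareProg k) I.input fun t τ => t ≤ prepareTime Z ∧ I.Prepared k τ ∧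
      SoundTable I.codeWeight I.costBound (I.table (k + 1) τ 7) ∅ ∧
      CompleteTable I.codeWeight (I.table (k + 1) τ 7) ∅ := by
  have h := I.loaded_input
  simp only [prepareProg, runs_seq, runs_const, runs_store]
  refine (runs_rankProg hI hZ h rfl).mono ?_
  rintro t1 σ1 ⟨ht1, f1, a1, hr, hr'⟩
  have h1 := h.mono (f1.mono (by norm_num)) fun a ha => a1 a (by omega)
  refine (runs_weightProg hZ h1).mono ?_
  rintro t2 σ2 ⟨ht2, f2, a2, hw, hB⟩
  have h2 := h1.mono f2 fun a ha => a2 a (by omega)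
  refine (runs_codeProg hZ h2).mono ?_
  rintro t3 σ3 ⟨ht3, f3, a3, h5, h6, h7, h8⟩
  have h3 := h2.mono (f3.mono (by norm_num)) fun a ha => by rw [a3]
  refine (runs_fillProg h5 hZ.pow).mono ?_
  rintro t4 σ4 ⟨ht4, f4, a4, hfill⟩
  have hP : I.Prepared k ((σ4.setReg 20 0).setArr 7 ((σ4.setReg 20 0).reg 6)
      ((σ4.setReg 20 0).reg 20)) := by
    have hP3 : I.Prepared k σ3 := ⟨h3, by rw [f3 _ (by norm_num), hB], h5, h6, h7, h8,
      by simpa [a3] using hw, by simpa [a3, a2 5] using hr, by simpa [a3, a2 5] using hr'⟩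
    refine hP3.mono (by simpa using f4.mono (by norm_num)) fun a ha => ?_
    rw [arr_setArr_of_ne _ _ _ (by omega)]
    exact a4 a (by omega)
  have hs : σ4.reg 6 = code (fun _ : Fin (k + 1) => I.s) := by rw [f4 _ (by norm_num), h6]
  refine ⟨by simp only [prepareTime]; omega, hP, soundTable_init ?_ ?_, completeTable_init ?_⟩
  · simp [table, hs]
  · intro c hc
    simp only [table, reg_setReg, arr_setArr_same, arr_setReg, if_true, if_false,
      Nat.reduceEqDiff, hs]
    rw [Function.update_of_ne (by rwa [Ne, code_inj]), hfill _ (code_lt c),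
      f3 _ (by norm_num), hB]
  · simp [table, hs]

/-! ### The dynamic program on the machine -/

/-- Register `50` receives the digit, of weight the register `28`, of the register `34`. -/
def digitProg : Prog :=
  .seq (copy 50 34) <| .seq (copy 51 28) <| .seq divProg <| .seq (copy 50 52) <|
    .seq (copy 51 0) divProg

def digitTime (Z : ℕ) : ℕ := 2 * divTime Z + 8

theorem runs_digitProg {Z : ℕ} (hZ : σ.reg 34 ≤ Z) (hp : 0 < σ.reg 28) (hn : 0 < σ.reg 0) :
    Runs digitProg σ fun t τ => t ≤ digitTime Z ∧ Frame 50 σ τ ∧ τ.arr = σ.arr ∧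
      τ.reg 50 = σ.reg 34 / σ.reg 28 % σ.reg 0 := by
  simp only [digitProg, runs_seq, runs_copy, ne_eq, not_false_eq_true, Nat.reduceEqDiff,
    OfNat.zero_ne_ofNat]
  refine (runs_divProg (by simpa using hZ) (by simpa using hp)).mono ?_
  rintro t1 σ1 ⟨ht1, f1, a1, q1, -⟩
  have hq : σ1.reg 52 ≤ Z := by
    rw [q1]; exact (Nat.div_le_self _ _).trans (by simpa using hZ)
  refine (runs_divProg (Z := Z) (by simpa using hq) (by simpa [f1 0] using hn)).mono ?_
  rintro t2 σ2 ⟨ht2, f2, a2, -, q2⟩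
  refine ⟨by simp only [digitTime]; omega, ?_, by simpa [a1] using a2, ?_⟩
  · have g1 : Frame 50 σ σ1 := Frame.trans (by simp [Frame.refl]) f1 le_rfl
    exact Frame.trans (by simpa using g1) f2 le_rfl
  · simpa [f1 0, q1] using q2

/-- The update of the entry numbered by register `34` that lets a token cross the edge. -/
def entryProg : Prog :=
  .seq digitProg <| .seq (.sub 36 50 25) <| .seq (.sub 37 25 50) <| .seq (.add 36 36 37) <|
    .ite 36 (.const 36 0) <|
      .seq (.add 36 34 32) <| .seq (.sub 36 36 33) <| .seq (.load 37 7 36) <|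
        .seq (.add 37 37 26) <| .seq (.load 38 8 36) <| .seq (.add 38 38 27) <|
          .seq (.sub 39 37 38) <| .seq (.sub 37 37 39) <| .seq (.load 38 8 34) <|
            .seq (.sub 39 38 37) <| .seq (.sub 38 38 39) <| .store 8 34 38

/-- The registers `24`, …, `28` describe the edge `e` and the token `i`. -/
structure EdgeLoaded (I : FTPInstance) (e : Fin I.m) (p : ℕ) (σ : Store) : Prop where
  tail : σ.reg 24 = I.tail e
  head : σ.reg 25 = I.head e
  weight : σ.reg 26 = I.codeWeight e
  penalty : σ.reg 27 = if e ∈ I.M then I.costBound else 0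
  pow : σ.reg 28 = p

theorem EdgeLoaded.mono {e : Fin I.m} {p : ℕ} (h : I.EdgeLoaded e p σ) (hf : Frame 29 σ τ) :
    I.EdgeLoaded e p τ := by
  obtain ⟨h1, h2, h3, h4, h5⟩ := h
  constructor
  all_goals rwa [hf _ (by norm_num)]

def entryTime (Z : ℕ) : ℕ := digitTime Z + 16

/-- The table `T'` before token `i` has been dealt with for the configuration numbers `≥ j`. -/
def partialTable (I : FTPInstance) {K : ℕ} (T T' : (Fin K → Fin I.n) → ℕ) (e : Fin I.m)
    (i : Fin K) (j : ℕ) (c : Fin K → Fin I.n) : ℕ :=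
  if code c < j then moveToken I.codeWeight I.costBound T T' e i c else T' c

theorem runs_entryProg {k Z j : ℕ} {e : Fin I.m} {i : Fin (k + 1)}
    {T T' : (Fin (k + 1) → Fin I.n) → ℕ} (hZ : I.Bound k Z) (hne : I.tail e ≠ I.head e)
    (hn : σ.reg 0 = I.n) (he : I.EdgeLoaded e (I.n ^ (i : ℕ)) σ)
    (h32 : σ.reg 32 = I.tail e * I.n ^ (i : ℕ)) (h33 : σ.reg 33 = I.head e * I.n ^ (i : ℕ))
    (hj : j < I.n ^ (k + 1)) (h34 : σ.reg 34 = j)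
    (hT : I.table (k + 1) σ 7 = T) (hT' : I.table (k + 1) σ 8 = I.partialTable T T' e i j) :
    Runs entryProg σ fun t τ => t ≤ entryTime Z ∧ Frame 36 σ τ ∧
      (∀ a ≠ 8, τ.arr a = σ.arr a) ∧
      I.table (k + 1) τ 8 = I.partialTable T T' e i (j + 1) := by
  obtain ⟨c, rfl⟩ := exists_code hj
  simp only [entryProg, runs_seq]
  refine (runs_digitProg (Z := Z) (by rw [h34]; exact hj.le.trans hZ.pow)
    (by rw [he.pow]; exact Nat.pow_pos I.n_pos) (by rw [hn]; exact I.n_pos)).mono ?_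
  rintro t τ ⟨ht, hf, ha, h50⟩
  rw [h34, he.pow, hn, code_digit] at h50
  have g25 := (hf 25 (by norm_num)).trans he.head
  have g26 := (hf 26 (by norm_num)).trans he.weight
  have g27 := (hf 27 (by norm_num)).trans he.penalty
  have g32 := (hf 32 (by norm_num)).trans h32
  have g33 := (hf 33 (by norm_num)).trans h33
  have g34 := (hf 34 (by norm_num)).trans h34
  have hf36 : Frame 36 σ τ := hf.mono (by norm_num)
  have other : ∀ d : Fin (k + 1) → Fin I.n, d ≠ c →
      I.partialTable T T' e i (code c + 1) d = I.partialTable T T' e i (code c) d := by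
    intro d hd
    have : code d ≠ code c := by rwa [Ne, code_inj]
    simp only [partialTable]
    by_cases h : code d < code c
    · rw [if_pos h, if_pos (by omega)]
    · rw [if_neg h, if_neg (by omega)]
  have self : I.partialTable T T' e i (code c + 1) c =
      moveToken I.codeWeight I.costBound T T' e i c := by simp [partialTable]
  have self' : I.partialTable T T' e i (code c) c = T' c := by simp [partialTable]
  simp only [runs_sub, runs_add]
  refine runs_ite (fun hb => ?_) (fun hb => ?_)
  · simp [h50, g25] at hb
    have hci : c i ≠ I.head e := by
      intro h; rw [h] at hb; omega
    simp only [runs_const]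
    refine ⟨by simp only [entryTime]; omega, by simpa using hf36, by simp [ha], ?_⟩
    funext d
    have : I.table (k + 1) τ 8 d = I.partialTable T T' e i (code c) d := by
      rw [← hT']; simp [table, ha]
    by_cases hd : d = c
    · subst hd
      rw [self, moveToken, if_neg hci, ← self', ← this]
      simp [table]
    · rw [other d hd, ← this]
      simp [table]
  · simp [h50, g25] at hb
    have hci : c i = I.head e := Fin.ext (by omega)
    -- The subtraction does not truncate: digit `i` of `code c` is the head.
    have hidx : code c + I.tail e * I.n ^ (i : ℕ) - I.head e * I.n ^ (i : ℕ) =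
        code (Function.update c i (I.tail e)) := by
      rw [← code_update, hci, Nat.add_sub_cancel]
    have h7 : σ.arr 7 (code (Function.update c i (I.tail e))) =
        T (Function.update c i (I.tail e)) := by rw [← hT]; rfl
    -- Updating array `8` in place is safe: the entry read has token `i` at the tail, which differs
    -- from the head, and `moveToken` leaves such entries unchanged.
    have h8 : σ.arr 8 (code (Function.update c i (I.tail e))) =
        T' (Function.update c i (I.tail e)) := by
      have : I.table (k + 1) σ 8 (Function.update c i (I.tail e)) =
          T' (Function.update c i (I.tail e)) := by
        rw [hT', partialTable, moveToken]
        simp [hne]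
      exact this
    have h8' : σ.arr 8 (code c) = T' c := by
      have := congrFun hT' c
      rwa [self'] at this
    have hmin (a b : ℕ) : a - (a - b) = min a b := by omega
    simp only [runs_seq, runs_add, runs_sub, runs_load, runs_store]
    simp [g26, g27, g32, g33, g34, hidx, ha, h7, h8, h8', hmin, hf36]
    refine ⟨by simp only [entryTime]; omega, fun a h => by
      rw [arr_setArr_of_ne _ _ _ h]; simp [ha], ?_⟩
    funext d
    by_cases hd : d = c
    · subst hd
      rw [self, moveToken, if_pos hci]
      simp [table]
    · rw [other d hd, ← hT']
      simp only [table, arr_setArr_same]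
      rw [Function.update_of_ne (by rwa [Ne, code_inj])]
      simp [ha]

/-- The update of array `8` that lets the token numbered by register `30` cross the edge. -/
def tokenProg : Prog :=
  .seq (copy 50 24) <| .seq (copy 51 28) <| .seq mulProg <| .seq (copy 32 52) <|
    .seq (copy 50 25) <| .seq (copy 51 28) <| .seq mulProg <| .seq (copy 33 52) <|
      .seq (forLoop 34 5 entryProg) <|
        .seq (copy 50 0) <| .seq (copy 51 28) <| .seq mulProg <| copy 28 52

def tokenTime (Z : ℕ) : ℕ := 3 * mulTime Z + (Z * (entryTime Z + 4) + 3) + 18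

theorem runs_tokenProg {k Z : ℕ} {e : Fin I.m} {i : Fin (k + 1)}
    (hZ : I.Bound k Z) (hne : I.tail e ≠ I.head e)
    (hn : σ.reg 0 = I.n) (h5 : σ.reg 5 = I.n ^ (k + 1))
    (he : I.EdgeLoaded e (I.n ^ (i : ℕ)) σ) :
    Runs tokenProg σ fun t τ => t ≤ tokenTime Z ∧ Frame 24 σ τ ∧
      τ.reg 30 = σ.reg 30 ∧ (∀ a ≠ 8, τ.arr a = σ.arr a) ∧
      I.EdgeLoaded e (I.n ^ (i + 1 : ℕ)) τ ∧
      I.table (k + 1) τ 8 = moveToken I.codeWeight I.costBound (I.table (k + 1) σ 7)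
        (I.table (k + 1) σ 8) e i := by
  have hsz : (σ.reg 28).size ≤ Z := by
    rw [he.pow]; exact (size_le_self _).trans (hZ.pow_le i.2.le)
  simp only [tokenProg, runs_seq, runs_copy, ne_eq, not_false_eq_true, Nat.reduceEqDiff,
    OfNat.zero_ne_ofNat]
  refine (runs_mulProg (by simpa using hsz)).mono ?_
  rintro t1 σ1 ⟨ht1, f1, a1, m1⟩
  simp [he.tail, he.pow] at m1 a1
  have g1 : Frame 50 σ σ1 := Frame.trans (by simp [Frame.refl]) f1 le_rfl
  refine (runs_mulProg (by simpa [g1 28] using hsz)).mono ?_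
  rintro t2 σ2 ⟨ht2, f2, a2, m2⟩
  simp [g1 25, g1 28, he.head, he.pow] at m2 a2
  have g2 : Frame 32 σ σ2 := Frame.trans (by simpa using g1.mono (by norm_num)) f2 (by norm_num)
  have h32 : σ2.reg 32 = I.tail e * I.n ^ (i : ℕ) := by
    rw [f2 _ (by norm_num)]; simp [m1]
  have htab : ∀ a, I.table (k + 1) σ2 a = I.table (k + 1) σ a := fun a => by
    funext c; simp [table, a2, a1]
  refine (runs_forLoop (T := entryTime Z) (L := I.n ^ (k + 1)) (Z := Z) (fun j υ =>
    Frame 32 σ υ ∧ υ.reg 32 = I.tail e * I.n ^ (i : ℕ) ∧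
    υ.reg 33 = I.head e * I.n ^ (i : ℕ) ∧ (∀ a ≠ 8, υ.arr a = σ.arr a) ∧
    I.table (k + 1) υ 8 =
      I.partialTable (I.table (k + 1) σ 7) (I.table (k + 1) σ 8) e i j)
    (by norm_num) ?_ hZ.pow ?_ ?_ ?_).mono ?_
  · simp [g2 5, h5]
  · rintro j υ υ' ⟨h1, h2, h3, h4, h6⟩ hfr har
    refine ⟨h1.trans hfr (by norm_num), ?_, ?_, by simpa [har] using h4, ?_⟩
    · rwa [hfr _ (by norm_num)]
    · rwa [hfr _ (by norm_num)]
    · rw [← h6]; funext c; simp [table, har]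
  · refine ⟨by simpa using g2, by simp [h32], by simp [m2], by simp [a2, a1], ?_⟩
    funext c
    simp [partialTable, table, a2, a1]
  · rintro j hj υ ⟨h1, h2, h3, h4, h6⟩ h34 hl
    refine (runs_entryProg (T := I.table (k + 1) σ 7) (T' := I.table (k + 1) σ 8) hZ hne
      (by rw [h1 _ (by norm_num), hn])
      (he.mono (h1.mono (by norm_num))) h2 h3 hj h34 ?_ h6).mono ?_
    · funext c; simp [table, h4]
    · rintro t ω ⟨ht, w1, w2, w3⟩
      refine ⟨ht, by rw [w1 _ (by norm_num), h34], by rw [w1 _ (by norm_num), hl],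
        h1.trans w1 (by norm_num), by rw [w1 _ (by norm_num), h2],
        by rw [w1 _ (by norm_num), h3], fun a ha => (w2 a ha).trans (h4 a ha), w3⟩
  · rintro t3 σ3 ⟨ht3, f3, -, -, a3, h8⟩
    refine (runs_mulProg (Z := Z) (by simpa [f3 28] using hsz)).mono ?_
    rintro t4 σ4 ⟨ht4, f4, a4, m4⟩
    simp [f3 28, f3 0, hn, he.pow] at m4 a4
    have g4 : Frame 32 σ σ4 := Frame.trans (by simpa using f3) f4 (by norm_num)
    refine ⟨by simp only [tokenTime]; omega, by simpa using g4.mono (by norm_num),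
      by simp [g4 30], by simpa [a4] using a3, ?_, ?_⟩
    · have := he.mono (g4.mono (by norm_num))
      exact ⟨by simp [this.tail], by simp [this.head], by simp [this.weight],
        by simp [this.penalty], by simp [m4, pow_succ']⟩
    · funext c
      have := congrFun h8 c
      simp [partialTable, code_lt, table] at this
      simp [table, a4, this]

/-- The update of array `7` by the edge numbered by register `22`. -/
def edgeProg : Prog :=
  .seq (.load 24 0 22) <| .seq (.load 25 1 22) <| .seq (.load 26 6 22) <|
    .seq (.load 27 4 22) <| .seq (.ite 27 (copy 27 4) (.const 27 0)) <|
      .seq (fillProg 8) <| .seq (.const 28 1) <| .seq (forLoop 30 8 tokenProg) <|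
        forLoop 30 5 <| .seq (.load 32 7 30) <| .seq (.load 33 8 30) <| .seq (.sub 34 32 33) <|
          .seq (.sub 32 32 34) <| .store 7 30 32

def edgeTime (Z : ℕ) : ℕ :=
  8 + fillTime Z + (Z * (tokenTime Z + 4) + 3) + (Z * (5 + 4) + 3)

theorem runs_edgeProg {k Z : ℕ} {e : Fin I.m} {L : Finset (Fin I.m)} (hZ : I.Bound k Z)
    (h : I.Prepared k σ) (h22 : σ.reg 22 = e)
    (hs : SoundTable I.codeWeight I.costBound (I.table (k + 1) σ 7) L)
    (hc : CompleteTable I.codeWeight (I.table (k + 1) σ 7) L)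
    (heL : e ∉ L) (hL : ∀ f, I.head f = I.tail e → f ∈ L) :
    Runs edgeProg σ fun t τ => t ≤ edgeTime Z ∧ Frame 24 σ τ ∧
      (∀ a < 7, τ.arr a = σ.arr a) ∧
      SoundTable I.codeWeight I.costBound (I.table (k + 1) τ 7) (insert e L) ∧
      CompleteTable I.codeWeight (I.table (k + 1) τ 7) (insert e L) := by
  have hne : I.tail e ≠ I.head e := fun heq => by
    have := h.rank e
    rw [heq] at this
    exact lt_irrefl _ this
  simp only [edgeProg, runs_seq, runs_load, runs_const]
  -- Everything after the penalty has been set, shared by both branches of the test; `s` is the time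
  -- already spent.
  have main : ∀ (ρ : Store) (s : ℕ), s ≤ 7 → Frame 24 σ ρ → ρ.arr = σ.arr →
      ρ.reg 24 = I.tail e → ρ.reg 25 = I.head e → ρ.reg 26 = I.codeWeight e →
      ρ.reg 27 = (if e ∈ I.M then I.costBound else 0) →
      Runs (fillProg 8) ρ fun t1 σ1 => Runs (forLoop 30 8 tokenProg) (σ1.setReg 28 1)
        fun t2 σ2 => Runs (forLoop 30 5 <| .seq (.load 32 7 30) <| .seq (.load 33 8 30) <|
          .seq (.sub 34 32 33) <| .seq (.sub 32 32 34) <| .store 7 30 32) σ2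
        fun t3 τ => s + (t1 + (1 + (t2 + t3))) ≤ edgeTime Z ∧ Frame 24 σ τ ∧
          (∀ a < 7, τ.arr a = σ.arr a) ∧
          SoundTable I.codeWeight I.costBound (I.table (k + 1) τ 7) (insert e L) ∧
          CompleteTable I.codeWeight (I.table (k + 1) τ 7) (insert e L) := by
    intro ρ s hs7 hf ha h24 h25 h26 h27
    have r5 : ρ.reg 5 = I.n ^ (k + 1) := by rw [hf _ (by norm_num), h.configs]
    refine (runs_fillProg r5 hZ.pow).mono ?_
    rintro t1 σ1 ⟨ht1, f1, a1, hfill⟩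
    have r4 : ρ.reg 4 = I.costBound := by rw [hf _ (by norm_num), h.bound]
    have g1 : Frame 24 σ σ1 := hf.trans f1 (by norm_num)
    refine (runs_forLoop (T := tokenTime Z) (L := k + 1) (Z := Z) (fun j υ =>
      Frame 24 σ υ ∧ (∀ a ≠ 8, υ.arr a = σ.arr a) ∧ I.EdgeLoaded e (I.n ^ j) υ ∧
      SoundMoves I.codeWeight I.costBound (I.table (k + 1) σ 7) (I.table (k + 1) υ 8) e j ∧
      CompleteMoves I.codeWeight (I.table (k + 1) σ 7) (I.table (k + 1) υ 8) e j)
      (by norm_num) ?_ hZ.tokens ?_ ?_ ?_).mono ?_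
    · simp [g1 8, h.tokens]
    · rintro j υ υ' ⟨h1, h2, h3, h4, h5⟩ hfr har
      refine ⟨h1.trans hfr (by norm_num), by simpa [har] using h2, h3.mono (hfr.mono (by norm_num)),
        ?_⟩
      have : I.table (k + 1) υ' 8 = I.table (k + 1) υ 8 := by funext c; simp [table, har]
      rw [this]
      exact ⟨h4, h5⟩
    · refine ⟨by simpa using g1, by simpa [ha] using a1, ⟨?_, ?_, ?_, ?_, ?_⟩,
        soundMoves_zero fun c => ?_, completeMoves_zero⟩
      · simp [f1 24, h24]
      · simp [f1 25, h25]
      · simp [f1 26, h26]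
      · simp [f1 27, h27]
      · simp
      · simp [table, hfill _ (code_lt c), r4]
    · rintro j hj υ ⟨h1, h2, h3, h4, h5⟩ h30 hl
      refine (runs_tokenProg (i := ⟨j, hj⟩) hZ hne (by rw [h1 _ (by norm_num), h.loaded.n])
        (by rw [h1 _ (by norm_num), h.configs]) h3).mono ?_
      rintro t ω ⟨ht, w1, w2, w3, w4, w5⟩
      have h7 : I.table (k + 1) υ 7 = I.table (k + 1) σ 7 := by
        funext c; simp [table, h2]
      rw [h7] at w5
      refine ⟨ht, w2.trans h30, by rw [w1 _ (by norm_num), hl], h1.trans w1 le_rfl,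
        fun a ha => (w3 a ha).trans (h2 a ha), w4, ?_⟩
      rw [w5]
      exact ⟨h4.moveToken, h5.moveToken⟩
    · rintro t2 σ2 ⟨ht2, f2, a2, -, hsm, hcm⟩
      refine (runs_forLoop (T := 5) (L := I.n ^ (k + 1)) (Z := Z) (fun j υ =>
        Frame 24 σ υ ∧ (∀ a < 7, υ.arr a = σ.arr a) ∧ υ.arr 8 = σ2.arr 8 ∧
        ∀ i, υ.arr 7 i = if i < j then min (σ.arr 7 i) (σ2.arr 8 i) else σ.arr 7 i)
        (by norm_num) ?_ hZ.pow ?_ ?_ ?_).mono ?_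
      · simp [f2 5, h.configs]
      · rintro j υ υ' ⟨h1, h2, h3, h4⟩ hfr har
        rw [har]
        exact ⟨h1.trans hfr (by norm_num), h2, h3, h4⟩
      · exact ⟨f2, fun a ha => a2 a (by omega), rfl, by simp [a2]⟩
      · rintro j hj υ ⟨h1, h2, h3, h4⟩ h30 hl
        have hmin (a b : ℕ) : a - (a - b) = min a b := by omega
        simp [h30, hl, h1, h3, hmin]
        refine ⟨fun a ha => ?_, fun i => ?_⟩
        · rw [arr_setArr_of_ne _ _ _ (by omega)]
          simpa using h2 a ha
        · rcases lt_trichotomy i j with hij | rfl | hij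
          · rw [Function.update_of_ne hij.ne, h4, if_pos hij, if_pos hij.le]
          · simp [h4]
          · rw [Function.update_of_ne hij.ne', h4, if_neg (by omega), if_neg (by omega)]
      · rintro t3 τ ⟨ht3, f3, a3, -, h7⟩
        have hmin : ∀ c, I.table (k + 1) τ 7 c =
            min (I.table (k + 1) σ 7 c) (I.table (k + 1) σ2 8 c) := fun c => by
          simp [table, h7, code_lt]
        exact ⟨by simp only [edgeTime]; omega, f3, a3, hs.step heL hsm hmin,
          hc.step heL hcm hL hmin⟩
  have l0 := h.loaded.tail e
  have l1 := h.loaded.head e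
  have l6 := h.weight e
  have l4 := h.loaded.fault e
  refine runs_ite (fun hb => ?_) (fun hb => ?_)
  · simp [h22, l4] at hb
    rw [runs_copy (by norm_num)]
    refine (main _ 7 le_rfl ?_ ?_ ?_ ?_ ?_ ?_).mono ?_
    · simp [Frame.refl]
    · simp
    · simp [h22, l0]
    · simp [h22, l1]
    · simp [h22, l6]
    · simp [hb, h.bound]
    · exact fun t1 σ1 H => H.mono fun t2 σ2 H => H.mono fun t3 σ3 H =>
        ⟨by have := H.1; omega, H.2⟩
  · simp [h22, l4] at hb
    rw [runs_const]
    refine (main _ 6 (by norm_num) ?_ ?_ ?_ ?_ ?_ ?_).mono ?_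
    · simp [Frame.refl]
    · simp
    · simp [h22, l0]
    · simp [h22, l1]
    · simp [h22, l6]
    · simp [hb]
    · exact fun t1 σ1 H => H.mono fun t2 σ2 H => H.mono fun t3 σ3 H =>
        ⟨by have := H.1; omega, H.2⟩

/-- The dynamic program: the edges are processed by increasing rank of the tail. -/
def sweepProg : Prog :=
  forLoop 20 0 <| forLoop 22 1 <| .seq (.load 24 0 22) <| .seq (.load 24 5 24) <|
    .seq (.sub 25 24 20) <| .seq (.sub 26 20 24) <| .seq (.add 25 25 26) <|
      .ite 25 (.const 25 0) edgeProg

def sweepTime (Z : ℕ) : ℕ := Z * ((Z * (edgeTime Z + 7 + 4) + 3) + 4) + 3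

theorem runs_sweepProg {k Z : ℕ} (hZ : I.Bound k Z) (h : I.Prepared k σ)
    (hs : SoundTable I.codeWeight I.costBound (I.table (k + 1) σ 7) ∅)
    (hc : CompleteTable I.codeWeight (I.table (k + 1) σ 7) ∅) :
    Runs sweepProg σ fun t τ => t ≤ sweepTime Z ∧ I.Prepared k τ ∧
      SoundTable I.codeWeight I.costBound (I.table (k + 1) τ 7) Finset.univ ∧
      CompleteTable I.codeWeight (I.table (k + 1) τ 7) Finset.univ := by
  -- The edges treated before edge `j` is inspected in round `R`. Scanning all edges once per rank
  -- replaces sorting.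
  let L : ℕ → ℕ → Finset (Fin I.m) := fun R j => Finset.univ.filter fun e =>
    σ.arr 5 (I.tail e) < R ∨ σ.arr 5 (I.tail e) = R ∧ e.val < j
  refine (runs_forLoop (T := Z * (edgeTime Z + 7 + 4) + 3) (L := I.n) (Z := Z) (fun R υ =>
    Frame 20 σ υ ∧ (∀ a < 7, υ.arr a = σ.arr a) ∧
    SoundTable I.codeWeight I.costBound (I.table (k + 1) υ 7) (L R 0) ∧
    CompleteTable I.codeWeight (I.table (k + 1) υ 7) (L R 0))
    (by norm_num) h.loaded.n hZ.n ?_ ?_ ?_).mono ?_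
  · rintro j υ υ' ⟨h1, h2, h3⟩ hfr har
    have : I.table (k + 1) υ' 7 = I.table (k + 1) υ 7 := by funext c; simp [table, har]
    rw [this, har]
    exact ⟨h1.trans hfr (by norm_num), h2, h3⟩
  · have : L 0 0 = ∅ := by simp [L]
    rw [this]
    exact ⟨Frame.refl _ _, fun _ _ => rfl, hs, hc⟩
  · rintro R hR υ ⟨h1, h2, h3, h4⟩ h20 hl
    refine (runs_forLoop (T := edgeTime Z + 7) (L := I.m) (Z := Z) (fun j ρ =>
      Frame 22 υ ρ ∧ (∀ a < 7, ρ.arr a = σ.arr a) ∧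
      SoundTable I.codeWeight I.costBound (I.table (k + 1) ρ 7) (L R j) ∧
      CompleteTable I.codeWeight (I.table (k + 1) ρ 7) (L R j))
      (by norm_num) ?_ hZ.m ?_ ?_ ?_).mono ?_
    · rw [h1 _ (by norm_num), h.loaded.m]
    · rintro j ρ ρ' ⟨g1, g2, g3⟩ hfr har
      have : I.table (k + 1) ρ' 7 = I.table (k + 1) ρ 7 := by funext c; simp [table, har]
      rw [this, har]
      exact ⟨g1.trans hfr (by norm_num), g2, g3⟩
    · exact ⟨Frame.refl _ _, h2, h3, h4⟩
    · rintro j hj ρ ⟨g1, g2, g3, g4⟩ g22 gl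
      let e : Fin I.m := ⟨j, hj⟩
      have gP : I.Prepared k ρ := h.mono (h1.trans g1 (by norm_num)) g2
      have g0 : ρ.arr 0 j = I.tail e := gP.loaded.tail e
      have g5 : ρ.arr 5 = σ.arr 5 := g2 5 (by norm_num)
      have g20 : ρ.reg 20 = R := by rw [g1 _ (by norm_num), h20]
      simp only [runs_seq, runs_load, runs_sub, runs_add]
      refine runs_ite (fun hb => ?_) (fun hb => ?_)
      · simp [g22, g0, g5, g20] at hb
        have hRe : σ.arr 5 (I.tail e) ≠ R := by
          intro h; simp [h] at hb
        have hLe : L R (j + 1) = L R j := by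
          ext f
          simp only [L, Finset.mem_filter, Finset.mem_univ, true_and]
          by_cases hf : f = e
          · subst hf; simp [hRe]
          · have : f.val ≠ j := fun h => hf (Fin.ext h)
            omega
        rw [hLe, runs_const]
        refine ⟨by omega, by simp [g22], by simp [gl], by simp [g1], by simpa using g2, ?_⟩
        exact ⟨g3, g4⟩
      · simp [g22, g0, g5, g20] at hb
        have hRe : σ.arr 5 (I.tail e) = R := by omega
        have hLe : L R (j + 1) = insert e (L R j) := by
          ext f
          simp only [L, Finset.mem_filter, Finset.mem_univ, true_and, Finset.mem_insert]
          by_cases hf : f = e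
          · subst hf; simp [hRe, e]
          · have : f.val ≠ j := fun h => hf (Fin.ext h)
            simp only [hf, false_or]
            omega
        have heL : e ∉ L R j := by simp [L, hRe, e]
        -- An edge entering the tail of `e` has a tail of smaller rank, so an earlier round treated
        -- it.
        have hin : ∀ f, I.head f = I.tail e → f ∈ L R j := by
          intro f hf
          have := h.rank f
          rw [hf] at this
          simp only [L, Finset.mem_filter, Finset.mem_univ, true_and]
          omega
        refine (runs_edgeProg (e := e) (L := L R j) hZ ?_ ?_ ?_ ?_ heL hin).mono ?_
        · exact gP.mono (by simp [Frame.refl]) (by simp)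
        · simp [g22, e]
        · exact g3
        · exact g4
        rintro t ω ⟨ht, w1, w2, w3, w4⟩
        rw [hLe]
        refine ⟨by omega, by simp [w1 22, g22], by simp [w1 1, gl], ?_, ?_, w3, w4⟩
        · exact Frame.trans (by simpa using g1) (w1.mono (by norm_num : 22 ≤ 24)) le_rfl
        · intro a ha
          rw [w2 a ha]
          simpa using g2 a ha
    · rintro t ρ ⟨ht, g1, g2, g3, g4⟩
      have hLe : L R I.m = L (R + 1) 0 := by
        ext f
        have := f.2
        simp only [L, Finset.mem_filter, Finset.mem_univ, true_and]
        omega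
      rw [hLe] at g3 g4
      exact ⟨ht, by rw [g1 _ (by norm_num), h20], by rw [g1 _ (by norm_num), hl],
        h1.trans g1 (by norm_num), g2, g3, g4⟩
  · rintro t τ ⟨ht, h1, h2, h3, h4⟩
    have hLe : L I.n 0 = Finset.univ := by
      ext f
      simp [L, h.rank_lt]
    rw [hLe] at h3 h4
    exact ⟨by simpa only [sweepTime] using ht, h.mono h1 h2, h3, h4⟩

/-- The output: the binary digits of the optimal value tell the optimal edge set. -/
def outputProg : Prog :=
  .seq (.load 24 7 7) <| .seq (.sub 25 4 24) <| .ite 25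
    (.seq (forLoop 26 1 <| .seq (.half 28 24) <| .seq (.add 29 28 28) <| .seq (.sub 29 24 29) <|
      .seq (.store 0 26 29) (copy 24 28)) (.const 0 1))
    (.const 0 0)

def outputTime (Z : ℕ) : ℕ := 3 + (Z * (6 + 4) + 3) + 1

theorem runs_outputProg {k Z : ℕ} (hZ : I.Bound k Z) (h : I.Prepared k σ)
    (hs : SoundTable I.codeWeight I.costBound (I.table (k + 1) σ 7) Finset.univ)
    (hc : CompleteTable I.codeWeight (I.table (k + 1) σ 7) Finset.univ) :
    Runs outputProg σ fun t τ => t ≤ outputTime Z ∧ I.IsCorrectOutput k τ := by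
  have ht : σ.arr 7 (σ.reg 7) = I.table (k + 1) σ 7 fun _ => I.t := by rw [h.target]; rfl
  set V := I.table (k + 1) σ 7 fun _ => I.t with hV
  simp only [outputProg, runs_seq, runs_load, runs_sub]
  refine runs_ite (fun hb => ?_) (fun hb => ?_)
  · simp [ht, h.bound] at hb
    obtain ⟨S, hS, hSV⟩ := hs.exists_feasible (by omega)
    rw [← hV] at hSV
    simp only [runs_seq, runs_const]
    refine (runs_forLoop (T := 6) (L := I.m) (Z := Z) (fun j υ =>
      υ.reg 1 = I.m ∧ υ.reg 24 = V / 2 ^ j ∧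
      ∀ e : Fin I.m, e.val < j → υ.arr 0 e = V / 2 ^ (e : ℕ) % 2)
      (by norm_num) ?_ hZ.m ?_ ?_ ?_).mono ?_
    · simp [h.loaded.m]
    · rintro j υ υ' ⟨h1, h2, h3⟩ hfr har
      refine ⟨?_, ?_, by simpa [har] using h3⟩
      · rwa [hfr _ (by norm_num)]
      · rwa [hfr _ (by norm_num)]
    · simp [h.loaded.m, ht]
    · rintro j hj υ ⟨h1, h2, h3⟩ h26 -
      simp only [runs_seq, runs_half, runs_add, runs_sub, runs_store, runs_copy, ne_eq,
        not_false_eq_true, Nat.reduceEqDiff]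
      simp [h26, h1, h2]
      refine ⟨by rw [Nat.div_div_eq_div_mul, pow_succ], fun e he => ?_⟩
      rcases Nat.lt_or_eq_of_le he with he | rfl
      · rw [Function.update_of_ne he.ne]
        exact h3 e he
      · simp only [Function.update_self]
        omega
    · rintro t τ ⟨ht, h1, h2, h3⟩
      refine ⟨by simp only [outputTime]; omega, .inl ⟨by simp, ?_⟩⟩
      -- The bits of the optimal value are the indicator of `S`, so the written set is the very set
      -- that soundness provides.
      have : I.outputSet (τ.setReg 0 1) = S := by
        ext e
        rw [outputSet, Finset.mem_filter, arr_setReg, h3 e e.2, hSV, sum_codeWeight_bit]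
        simp
      rw [this]
      exact ⟨hS, fun S' hS' => cost_le_of_sum_codeWeight_le (hSV ▸ hc.le hS')⟩
  · simp [ht, h.bound] at hb
    rw [runs_const]
    refine ⟨by simp only [outputTime]; omega, .inr ⟨by simp, fun S hS => ?_⟩⟩
    -- Any feasible set would force the entry below `costBound`, which exceeds the sum of all
    -- weights.
    have h1 := hc.le hS
    have h2 : ∑ e ∈ S, I.codeWeight e ≤ ∑ e, I.codeWeight e :=
      Finset.sum_le_sum_of_subset (Finset.subset_univ _)
    simp only [costBound] at hb
    omega

/-! ### The theorem -/

/-- The algorithm. -/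
def solveProg (k : ℕ) : Prog := .seq (prepareProg k) (.seq sweepProg outputProg)

def solveTime (Z : ℕ) : ℕ := prepareTime Z + sweepTime Z + outputTime Z

theorem runs_solveProg {k Z : ℕ} (hI : I.IsAcyclic) (hZ : I.Bound k Z) :
    Runs (solveProg k) I.input fun t τ => t ≤ solveTime Z ∧ I.IsCorrectOutput k τ := by
  simp only [solveProg, runs_seq]
  refine (runs_prepareProg hI hZ).mono ?_
  rintro t1 σ1 ⟨ht1, h1, hs1, hc1⟩
  refine (runs_sweepProg hZ h1 hs1 hc1).mono ?_
  rintro t2 σ2 ⟨ht2, h2, hs2, hc2⟩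
  refine (runs_outputProg hZ h2 hs2 hc2).mono ?_
  rintro t3 σ3 ⟨ht3, h3⟩
  exact ⟨by simp only [solveTime]; omega, h3⟩

/-! ### The running time as a polynomial in the instance size. -/

theorem bound_size (I : FTPInstance) (k : ℕ) : I.Bound k (I.size ^ (k + 1) + I.size + k + 1) := by
  have hw : ∀ e, (I.weight e).num.size + (I.weight e).den.size ≤ I.size := fun e => by
    have := Finset.single_le_sum
      (f := fun e => (I.weight e).num.size + (I.weight e).den.size)
      (fun _ _ => Nat.zero_le _) (Finset.mem_univ e)
    simp only [size]
    omega
  have hn : I.n ≤ I.size := by simp only [size]; omega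
  have hm : I.m ≤ I.size := by simp only [size]; omega
  have hp := Nat.pow_le_pow_left hn (k + 1)
  constructor
  · omega
  · omega
  · omega
  · omega
  · intro e; have := hw e; omega
  · intro e; have := hw e; omega

/-- The function `f` is given by a polynomial. -/
def IsPolynomial (f : ℕ → ℕ) : Prop := ∃ p : Polynomial ℕ, ∀ N, p.eval N = f N

theorem IsPolynomial.add {f g : ℕ → ℕ} (hf : IsPolynomial f) (hg : IsPolynomial g) :
    IsPolynomial fun N => f N + g N := by
  obtain ⟨p, hp⟩ := hf
  obtain ⟨q, hq⟩ := hg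
  exact ⟨p + q, fun N => by rw [Polynomial.eval_add, hp, hq]⟩

theorem IsPolynomial.mul {f g : ℕ → ℕ} (hf : IsPolynomial f) (hg : IsPolynomial g) :
    IsPolynomial fun N => f N * g N := by
  obtain ⟨p, hp⟩ := hf
  obtain ⟨q, hq⟩ := hg
  exact ⟨p * q, fun N => by rw [Polynomial.eval_mul, hp, hq]⟩

theorem IsPolynomial.const (c : ℕ) : IsPolynomial fun _ => c :=
  ⟨.C c, fun _ => Polynomial.eval_C⟩


theorem isPolynomial_solveTime (q : Polynomial ℕ) :
    IsPolynomial fun N => solveTime (q.eval N) := by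
  have hq : IsPolynomial fun N => q.eval N := ⟨q, fun _ => rfl⟩
  simp only [solveTime, prepareTime, sweepTime, outputTime, rankTime, weightTime, codeTime,
    fillTime, edgeTime, tokenTime, entryTime, digitTime, mulTime, divTime]
  -- Unfolded, the time is built from constants and `q` by sums and products only.
  repeat' first
    | exact hq
    | exact .const _
    | refine .add ?_ ?_
    | refine .mul ?_ ?_

end FTPInstance

theorem theorem2 (k : ℕ) :
    RAM.SolvableInPolyTime FTPInstance.IsAcyclic FTPInstance.input FTPInstance.size
      (FTPInstance.IsCorrectOutput k) := by
  obtain ⟨p, hp⟩ := FTPInstance.isPolynomial_solveTime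
    (.X ^ (k + 1) + .X + .C (k + 1))
  refine ⟨FTPInstance.solveProg k, p, fun I hI => ?_⟩
  obtain ⟨t, τ, h, ht, hc⟩ := FTPInstance.runs_solveProg hI (I.bound_size k)
  refine ⟨t, τ, h, ?_, hc⟩
  rw [hp]
  simpa [add_assoc] using ht
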